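/- A directed graph $E=(E^0,E^1,r,s)$ consists of countable sets of vertices and edges and maps $r,s\colon E^1\to E^0$; it is row-finite if every $r^{-1}(v)$ is finite, and a vertex $v$ is a source if $r^{-1}(v)=\varnothing$. For a row-finite graph $E$, $C^*(E)$ is the universal C*-algebra generated by mutually orthogonal projections $p_v$ $(v\in E^0)$ and partial isometries $s_e$ $(e\in E^1)$ with mutually orthogonal ranges such that $s_e^*s_e=p_{s(e)}$ for all $e$ and $p_v=\sum_{r(e)=v}s_es_e^*$ for every $v$ that is not a source. For $f\colon E^1\to\mathbb Z$ (an edge function), $\gamma^{E,f}$ is the action of the circle group $\mathbb T$ on $C^*(E)$ with $\gamma^{E,f}_z(s_e)=z^{f(e)}s_e$ and $\gamma^{E,f}_z(p_v)=p_v$. The diagonal $\mathcal D(E)\subseteq C^*(E)$ is the C*-subalgebra generated by the projections $s_\mu s_\mu^*$, where $\mu=e_1\cdots e_n$ runs over the finite paths ($s(e_i)=r(e_{i+1})$, $s_\mu=s_{e_1}\cdots s_{e_n}$), vertices included ($s_v=p_v$). An out-split of $E_1$ is given as follows. For each $v\in E_1^0$ that is not a source, partition $s_1^{-1}(v)$ into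 nonempty sets $\mathcal E_v^1,\mathcal E_v^2,\dots,\mathcal E_v^{m(v)}$ (so $m(v)=0$ if $s_1^{-1}(v)=\varnothing$; $m(v)=\infty$ is allowed); if $v$ is a source, put $m(v)=0$ and do not partition. The out-split graph $E_2$ has vertices $\bar v^i$ for $v\in E_1^0$, $1\le i\le m(v)$, $i<\infty$, together with $\bar v$ for $v\in E_1^0$ with $m(v)=0$, and edges $\bar e^j$ for $e\in E_1^1$, $1\le j\le m(r_1(e))$, $j<\infty$, together with $\bar e$ for $e\in E_1^1$ with $m(r_1(e))=0$. The range maps are $r_2(\bar e^j)=\overline{r_1(e)}^{\,j}$ and $r_2(\bar e)=\overline{r_1(e)}$; the source of $\bar e^j$ and of $\bar e$ is $\overline{s_1(e)}^{\,i}$ if $e\in\mathcal E^i_{s_1(e)}$, and $\overline{s_1(e)}$ if $m(s_1(e))=0$. The out-split is proper if $m(v)=1$ whenever $r_1^{-1}(v)$ is infinite. Triples $(A_1,\alpha_1,D_1)$ and $(A_2,\alpha_2,D_2)$, each consisting of a C*-algebra, an action of $\mathbb T$ and a subalgebra, are called Morita equivalent if there are a C*-algebra $C$, full projections $P_1,P_2$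 in its multiplier algebra with $P_1+P_2=1$, *-isomorphisms $\pi_i\colon A_i\to P_iCP_i$, an action $\gamma$ of $\mathbb T$ on $C$ with $\pi_i\circ\alpha_{i,z}=\gamma_z\circ\pi_i$ for all $z\in\mathbb T$ and $i=1,2$, and a commutative C*-subalgebra $D\subseteq C$ whose normalisers $\{n\in C: nDn^*\subseteq D,\ n^*Dn\subseteq D\}$ have dense linear span in $C$, such that $\pi_i(D_i)=P_iD$ for $i=1,2$. All actions are strongly continuous and by *-automorphisms. **Theorem.** Let $E_1$ be a row-finite directed graph and let $E_2$ be a proper out-split of $E_1$. For every edge function $f\colon E_1^1\to\mathbb Z$ there is an edge function $g\colon E_2^1\to\mathbb Z$ such that the triples $(C^*(E_1),\gamma^{E_1,f},\mathcal D(E_1))$ and $(C^*(E_2),\gamma^{E_2,g},\mathcal D(E_2))$ are Morita equivalent. -/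

import Mathlib

universe u w

noncomputable section

/-- A directed graph: countable sets of vertices and edges, with range and source maps. -/
structure DirectedGraph where
  Vertex : Type u
  Edge : Type u
  r : Edge → Vertex
  s : Edge → Vertex
  countable_vertex : Countable Vertex
  countable_edge : Countable Edge

namespace DirectedGraph

/-- Every vertex receives finitely many edges. -/
def RowFinite (E : DirectedGraph.{u}) : Prop :=
  ∀ v : E.Vertex, (E.r ⁻¹' {v}).Finite

/-- A source is a vertex that receives no edge. -/
def IsSource (E : DirectedGraph.{u}) (v : E.Vertex) : Prop :=
  E.r ⁻¹' {v} = ∅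

/-- The defining relations of a Cuntz-Krieger `E`-family `{S, P}`, where `R x y` plays the role of
`x = y`: the `P v` are mutually orthogonal projections, the `S e` have mutually orthogonal ranges,
(CK1) `S e* S e = P (s e)`, and (CK2) `P v = ∑ S e S e*`, the sum over the edges `e` with range `v`,
whenever `v` is not a source. That `S e` is a partial isometry is part of (CK1), as `P (s e)` is a
projection. For row-finite graphs `range_le` follows from (CK2) and the finiteness hypothesis in
`ck2` is void. -/
structure CKRelations (E : DirectedGraph.{u}) {A : Type w} [NonUnitalRing A] [StarRing A]
    (R : A → A → Prop) (S : E.Edge → A) (P : E.Vertex → A) : Prop where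
  star_proj : ∀ v, R (star (P v)) (P v)
  proj_mul_self : ∀ v, R (P v * P v) (P v)
  proj_orthogonal : ∀ v w, v ≠ w → R (P v * P w) 0
  range_orthogonal : ∀ e e', e ≠ e' → R (star (S e) * S e') 0
  range_le : ∀ e, R (P (E.r e) * S e) (S e)
  ck1 : ∀ e, R (star (S e) * S e) (P (E.s e))
  ck2 : ∀ (v : E.Vertex) (hv : (E.r ⁻¹' {v}).Finite), ¬ E.IsSource v →
    R (P v) (∑ e ∈ hv.toFinset, S e * star (S e))

/-- A Cuntz-Krieger `E`-family in a C*-algebra (or any *-ring) `A`. -/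
def IsCKFamily (E : DirectedGraph.{u}) {A : Type w} [NonUnitalRing A] [StarRing A]
    (S : E.Edge → A) (P : E.Vertex → A) : Prop :=
  E.CKRelations (fun x y => x = y) S P

end DirectedGraph

/-! ### The free *-algebra on the vertices and edges of a graph -/

/-- The letters `p v`, `s e` and `(s e)*`. -/
inductive CKLetter (E : DirectedGraph.{u}) : Type u
  | proj (v : E.Vertex)
  | iso (e : E.Edge)
  | isoStar (e : E.Edge)

/-- The involution on letters. -/
def CKLetter.inv {E : DirectedGraph.{u}} : CKLetter E → CKLetter E
  | proj v => proj v
  | iso e => isoStar e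
  | isoStar e => iso e

/-- The involution on nonempty words: reverse the word and apply the involution to each letter. -/
def ckWordStar {E : DirectedGraph.{u}} (x : FreeSemigroup (CKLetter E)) :
    FreeSemigroup (CKLetter E) :=
  MulOpposite.unop
    (FreeSemigroup.lift (fun a => MulOpposite.op (FreeSemigroup.of a.inv)) x)

theorem ckWordStar_mul {E : DirectedGraph.{u}} (x y : FreeSemigroup (CKLetter E)) :
    ckWordStar (x * y) = ckWordStar y * ckWordStar x := by
  simp [ckWordStar]

theorem ckWordStar_ckWordStar {E : DirectedGraph.{u}} (x : FreeSemigroup (CKLetter E)) :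
    ckWordStar (ckWordStar x) = x := by
  induction x using FreeSemigroup.recOnMul with
  | ih1 a => cases a <;> simp [ckWordStar, CKLetter.inv]
  | ih2 a y _ ih =>
    rw [ckWordStar_mul, ckWordStar_mul, ih]
    cases a <;> rfl

/-- The free complex *-algebra on the vertices (as selfadjoint generators) and the edges, without
unit: finite linear combinations of nonempty words. -/
def CKFree (E : DirectedGraph.{u}) : Type u := MonoidAlgebra ℂ (FreeSemigroup (CKLetter E))

namespace CKFree

variable {E : DirectedGraph.{u}}

instance : NonUnitalRing (CKFree E) :=
  inferInstanceAs (NonUnitalRing (MonoidAlgebra ℂ (FreeSemigroup (CKLetter E))))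

instance : Module ℂ (CKFree E) :=
  inferInstanceAs (Module ℂ (MonoidAlgebra ℂ (FreeSemigroup (CKLetter E))))

instance : IsScalarTower ℂ (CKFree E) (CKFree E) :=
  inferInstanceAs (IsScalarTower ℂ (MonoidAlgebra ℂ (FreeSemigroup (CKLetter E)))
    (MonoidAlgebra ℂ (FreeSemigroup (CKLetter E))))

instance : SMulCommClass ℂ (CKFree E) (CKFree E) :=
  inferInstanceAs (SMulCommClass ℂ (MonoidAlgebra ℂ (FreeSemigroup (CKLetter E)))
    (MonoidAlgebra ℂ (FreeSemigroup (CKLetter E))))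

/-- The scalar multiple `c • x` of a word `x`. -/
def word (x : FreeSemigroup (CKLetter E)) (c : ℂ) : CKFree E :=
  MonoidAlgebra.single x c

theorem word_mul_word (x y : FreeSemigroup (CKLetter E)) (c d : ℂ) :
    word x c * word y d = word (x * y) (c * d) :=
  MonoidAlgebra.single_mul_single x y c d

theorem smul_word (x : FreeSemigroup (CKLetter E)) (c d : ℂ) :
    c • word x d = word x (c * d) :=
  MonoidAlgebra.smul_single c x d

theorem word_add (x : FreeSemigroup (CKLetter E)) (c d : ℂ) :
    word x (c + d) = word x c + word x d :=
  MonoidAlgebra.single_add x c d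

theorem word_zero (x : FreeSemigroup (CKLetter E)) : word x 0 = 0 :=
  MonoidAlgebra.single_zero x

theorem induction_word {motive : CKFree E → Prop} (x : CKFree E) (zero : motive 0)
    (add : ∀ x y, motive x → motive y → motive (x + y))
    (word : ∀ m c, motive (word m c)) : motive x :=
  MonoidAlgebra.induction_linear (motive := motive) x zero add word

/-- The additive map `∑ c_x x ↦ ∑ conj(c_x) x*`. -/
def starHom : CKFree E →+ CKFree E :=
  (Finsupp.liftAddHom (fun x : FreeSemigroup (CKLetter E) =>
    ((AddMonoidHom.mk' (word (ckWordStar x)) (word_add _)).comp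
      (starRingEnd ℂ : ℂ →+* ℂ).toAddMonoidHom))).comp
    (MonoidAlgebra.coeffAddEquiv.toAddMonoidHom)

theorem starHom_word (x : FreeSemigroup (CKLetter E)) (c : ℂ) :
    starHom (word x c) = word (ckWordStar x) (starRingEnd ℂ c) := by
  change Finsupp.liftAddHom _ (Finsupp.single x c) = _
  rw [Finsupp.liftAddHom_apply_single]
  rfl

instance : StarRing (CKFree E) where
  star := starHom
  star_involutive x := by
    induction x using induction_word with
    | zero => simp
    | add x y hx hy => simp [hx, hy]
    | word m c => simp [starHom_word, ckWordStar_ckWordStar]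
  star_mul x y := by
    induction x using induction_word with
    | zero => simp
    | add x x' hx hx' => simp [add_mul, mul_add, hx, hx']
    | word m c =>
      induction y using induction_word with
      | zero => simp
      | add x x' hx hx' => simp [add_mul, mul_add, hx, hx']
      | word n d => simp [starHom_word, word_mul_word, ckWordStar_mul, mul_comm]
  star_add x y := starHom.map_add x y

theorem star_word (x : FreeSemigroup (CKLetter E)) (c : ℂ) :
    star (word x c) = word (ckWordStar x) (starRingEnd ℂ c) := starHom_word x c

instance : StarModule ℂ (CKFree E) where
  star_smul c x := by
    induction x using induction_word with
    | zero => simp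
    | add x y hx hy => simp [hx, hy]
    | word m d => simp [star_word, smul_word]

/-- The generator of an edge. -/
def iso (e : E.Edge) : CKFree E := word (FreeSemigroup.of (CKLetter.iso e)) 1

/-- The generator of a vertex. -/
def proj (v : E.Vertex) : CKFree E := word (FreeSemigroup.of (CKLetter.proj v)) 1

theorem star_iso (e : E.Edge) :
    star (iso e) = word (FreeSemigroup.of (CKLetter.isoStar e)) 1 := by
  simp [iso, star_word, ckWordStar, CKLetter.inv]

theorem star_proj (v : E.Vertex) : star (proj v) = proj v := by
  simp [proj, star_word, ckWordStar, CKLetter.inv]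

/-- Induction over the *-algebra operations. -/
theorem induction_gen {motive : CKFree E → Prop} (x : CKFree E) (zero : motive 0)
    (add : ∀ x y, motive x → motive y → motive (x + y))
    (smul : ∀ (c : ℂ) x, motive x → motive (c • x))
    (mul : ∀ x y, motive x → motive y → motive (x * y))
    (iso : ∀ e, motive (iso e)) (star_iso : ∀ e, motive (star (CKFree.iso e)))
    (proj : ∀ v, motive (proj v)) : motive x := by
  have hof : ∀ a : CKLetter E, motive (word (FreeSemigroup.of a) 1) := by
    intro a
    cases a with
    | proj v => exact proj v
    | iso e => exact iso e
    | isoStar e => rw [← CKFree.star_iso]; exact star_iso e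
  have hw : ∀ m : FreeSemigroup (CKLetter E), motive (word m 1) := by
    intro m
    induction m using FreeSemigroup.recOnMul with
    | ih1 a => exact hof a
    | ih2 a y ha hy =>
      have := mul _ _ ha hy
      rwa [word_mul_word, one_mul] at this
  induction x using induction_word with
  | zero => exact zero
  | add x y hx hy => exact add x y hx hy
  | word m c =>
    have := smul c _ (hw m)
    rwa [smul_word, mul_one] at this

/-- Evaluation of letters at elements of a *-algebra. -/
def evalLetter {A : Type w} [NonUnitalRing A] [StarRing A] (S : E.Edge → A) (P : E.Vertex → A) :
    CKLetter E → A
  | CKLetter.proj v => P v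
  | CKLetter.iso e => S e
  | CKLetter.isoStar e => star (S e)

/-- The *-homomorphism out of the free *-algebra determined by its values on the generators. -/
def eval {A : Type w} [NonUnitalRing A] [StarRing A] [Module ℂ A] [IsScalarTower ℂ A A]
    [SMulCommClass ℂ A A] [StarModule ℂ A] (S : E.Edge → A) (P : E.Vertex → A)
    (hP : ∀ v, star (P v) = P v) : CKFree E →⋆ₙₐ[ℂ] A :=
  let φ : CKFree E →ₙₐ[ℂ] A :=
    MonoidAlgebra.liftMagma ℂ (FreeSemigroup.lift (evalLetter S P))
  have hφ : ∀ m c, φ (word m c) = c • FreeSemigroup.lift (evalLetter S P) m := fun m c => by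
    change Finsupp.liftAddHom _ (Finsupp.single m c) = _
    simp
  { φ with
    map_star' := fun x => by
      change φ (star x) = star (φ x)
      have h1 : ∀ m : FreeSemigroup (CKLetter E),
          FreeSemigroup.lift (evalLetter S P) (ckWordStar m)
            = star (FreeSemigroup.lift (evalLetter S P) m) := by
        intro m
        have hof : ∀ a : CKLetter E, FreeSemigroup.lift (evalLetter S P)
            (ckWordStar (FreeSemigroup.of a)) = star (evalLetter S P a) := by
          intro a
          cases a <;> simp [ckWordStar, CKLetter.inv, evalLetter, hP]
        induction m using FreeSemigroup.recOnMul with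
        | ih1 a => simpa using hof a
        | ih2 a y _ hy => rw [ckWordStar_mul, map_mul, map_mul, star_mul, hy, hof]; simp
      induction x using induction_word with
      | zero => simp
      | add x y hx hy => simp [hx, hy]
      | word m c => rw [star_word, hφ, hφ, h1, star_smul]; rfl }

section Eval

variable {A : Type w} [NonUnitalRing A] [StarRing A] [Module ℂ A] [IsScalarTower ℂ A A]
    [SMulCommClass ℂ A A] [StarModule ℂ A] (S : E.Edge → A) (P : E.Vertex → A)
    (hP : ∀ v, star (P v) = P v)

theorem eval_iso (e : E.Edge) : eval S P hP (iso e) = S e := by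
  change MonoidAlgebra.liftMagma ℂ (FreeSemigroup.lift (evalLetter S P))
    (MonoidAlgebra.single _ _) = _
  simp [MonoidAlgebra.liftMagma, evalLetter]

theorem eval_proj (v : E.Vertex) : eval S P hP (proj v) = P v := by
  change MonoidAlgebra.liftMagma ℂ (FreeSemigroup.lift (evalLetter S P))
    (MonoidAlgebra.single _ _) = _
  simp [MonoidAlgebra.liftMagma, evalLetter]

end Eval

end CKFree

/-! ### The graph C*-algebra -/

/-- The C*-seminorms on the free *-algebra for which the generators satisfy the Cuntz-Krieger
relations. -/
structure CKSeminorm (E : DirectedGraph.{u}) extends Seminorm ℂ (CKFree E) where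
  mul_le' : ∀ x y, toFun (x * y) ≤ toFun x * toFun y
  star_mul_self' : ∀ x, toFun (star x * x) = toFun x * toFun x
  relations' : E.CKRelations (fun x y => toFun (x - y) = 0) CKFree.iso CKFree.proj

namespace CKSeminorm

variable {E : DirectedGraph.{u}}

theorem eq_of_rel (p : CKSeminorm E) {x y : CKFree E} (h : p.toSeminorm (x - y) = 0) :
    p.toSeminorm x = p.toSeminorm y := by
  have h1 := map_sub_le_add p.toSeminorm (x - y) (-y)
  have h2 := map_sub_le_add p.toSeminorm (y - x) (-x)
  have h3 : p.toSeminorm (y - x) = 0 := by rw [← h, map_sub_rev]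
  simp only [map_neg_eq_map, sub_neg_eq_add, sub_add_cancel] at h1 h2
  linarith

theorem mul_le (p : CKSeminorm E) (x y : CKFree E) :
    p.toSeminorm (x * y) ≤ p.toSeminorm x * p.toSeminorm y := p.mul_le' x y

theorem star_mul_self (p : CKSeminorm E) (x : CKFree E) :
    p.toSeminorm (star x * x) = p.toSeminorm x * p.toSeminorm x := p.star_mul_self' x

theorem relations (p : CKSeminorm E) :
    E.CKRelations (fun x y => p.toSeminorm (x - y) = 0) CKFree.iso CKFree.proj := p.relations'

theorem proj_le_one (p : CKSeminorm E) (v : E.Vertex) : p.toSeminorm (CKFree.proj v) ≤ 1 := by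
  have h1 := p.eq_of_rel (p.relations.proj_mul_self v)
  have h2 := p.star_mul_self (CKFree.proj v)
  rw [CKFree.star_proj, h1] at h2
  nlinarith [apply_nonneg p.toSeminorm (CKFree.proj v)]

theorem iso_le_one (p : CKSeminorm E) (e : E.Edge) : p.toSeminorm (CKFree.iso e) ≤ 1 := by
  have h1 := p.eq_of_rel (p.relations.ck1 e)
  have h2 := p.star_mul_self (CKFree.iso e)
  rw [h1] at h2
  nlinarith [apply_nonneg p.toSeminorm (CKFree.iso e), p.proj_le_one (E.s e)]

theorem star_le (p : CKSeminorm E) (x : CKFree E) : p.toSeminorm (star x) ≤ p.toSeminorm x := by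
  have h1 := p.star_mul_self (star x)
  have h2 := p.mul_le x (star x)
  rw [star_star] at h1
  rw [h1] at h2
  by_contra! h
  nlinarith [apply_nonneg p.toSeminorm x]

theorem bddAbove (x : CKFree E) :
    BddAbove (Set.range fun p : CKSeminorm E => p.toSeminorm x) := by
  suffices h : ∃ M, ∀ p : CKSeminorm E, p.toSeminorm x ≤ M by
    obtain ⟨M, hM⟩ := h
    exact ⟨M, by rintro _ ⟨p, rfl⟩; exact hM p⟩
  induction x using CKFree.induction_gen with
  | zero => exact ⟨0, fun p => by simp⟩
  | add x y hx hy =>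
    obtain ⟨M, hM⟩ := hx
    obtain ⟨N, hN⟩ := hy
    exact ⟨M + N, fun p => (map_add_le_add _ _ _).trans (add_le_add (hM p) (hN p))⟩
  | smul c x hx =>
    obtain ⟨M, hM⟩ := hx
    exact ⟨‖c‖ * M, fun p => by
      rw [map_smul_eq_mul]; exact mul_le_mul_of_nonneg_left (hM p) (norm_nonneg _)⟩
  | mul x y hx hy =>
    obtain ⟨M, hM⟩ := hx
    obtain ⟨N, hN⟩ := hy
    exact ⟨M * N, fun p => (p.mul_le x y).trans (mul_le_mul (hM p) (hN p)
      (apply_nonneg _ _) ((apply_nonneg p.toSeminorm x).trans (hM p)))⟩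
  | iso e => exact ⟨1, fun p => p.iso_le_one e⟩
  | star_iso e => exact ⟨1, fun p => (p.star_le _).trans (p.iso_le_one e)⟩
  | proj v => exact ⟨1, fun p => p.proj_le_one v⟩

instance : Inhabited (CKSeminorm E) where
  default :=
    { (0 : Seminorm ℂ (CKFree E)) with
      mul_le' := fun x y => by
        change (0 : ℝ) ≤ 0 * 0
        simp
      star_mul_self' := fun x => by
        change (0 : ℝ) = 0 * 0
        simp
      relations' := by constructor <;> intros <;> rfl }

end CKSeminorm

namespace CKFree

variable {E : DirectedGraph.{u}}

/-- The universal norm: the largest C*-seminorm that satisfies the Cuntz-Krieger relations. -/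
def univNorm (x : CKFree E) : ℝ := ⨆ p : CKSeminorm E, p.toSeminorm x

theorem le_univNorm (p : CKSeminorm E) (x : CKFree E) : p.toSeminorm x ≤ univNorm x :=
  le_ciSup (CKSeminorm.bddAbove x) p

theorem univNorm_le {x : CKFree E} {M : ℝ} (h : ∀ p : CKSeminorm E, p.toSeminorm x ≤ M) :
    univNorm x ≤ M := ciSup_le h

theorem univNorm_nonneg (x : CKFree E) : 0 ≤ univNorm x :=
  (apply_nonneg (default : CKSeminorm E).toSeminorm x).trans (le_univNorm _ x)

instance : NonUnitalSeminormedRing (CKFree E) :=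
  { (inferInstance : NonUnitalRing (CKFree E)),
    (AddGroupSeminorm.toSeminormedAddCommGroup
      { toFun := univNorm
        map_zero' := by simp [univNorm]
        add_le' := fun x y => univNorm_le fun p => (map_add_le_add _ _ _).trans
          (add_le_add (le_univNorm p x) (le_univNorm p y))
        neg' := fun x => by simp [univNorm] } : SeminormedAddCommGroup (CKFree E)) with
    norm_mul_le := fun x y => univNorm_le fun p => (p.mul_le x y).trans
      (mul_le_mul (le_univNorm p x) (le_univNorm p y) (apply_nonneg _ _) (univNorm_nonneg _)) }

theorem norm_eq (x : CKFree E) : ‖x‖ = univNorm x := rfl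

instance : NormedSpace ℂ (CKFree E) where
  norm_smul_le c x := univNorm_le fun p => by
    rw [map_smul_eq_mul]
    exact mul_le_mul_of_nonneg_left (le_univNorm p x) (norm_nonneg _)

instance : NormedStarGroup (CKFree E) where
  norm_star_le x := univNorm_le fun p => (p.star_le x).trans (le_univNorm p x)

theorem norm_mul_self_le (x : CKFree E) : ‖x‖ * ‖x‖ ≤ ‖star x * x‖ := by
  have h : ‖x‖ ≤ Real.sqrt ‖star x * x‖ := univNorm_le fun p => by
    apply Real.le_sqrt_of_sq_le
    rw [pow_two, ← p.star_mul_self]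
    exact le_univNorm p _
  calc ‖x‖ * ‖x‖ ≤ Real.sqrt ‖star x * x‖ * Real.sqrt ‖star x * x‖ :=
        mul_self_le_mul_self (norm_nonneg _) h
    _ = ‖star x * x‖ := Real.mul_self_sqrt (norm_nonneg _)

end CKFree

/-- The graph C*-algebra `C*(E)`: the (Hausdorff) completion of the free *-algebra in the universal
norm. -/
def GraphCStar (E : DirectedGraph.{u}) : Type u := UniformSpace.Completion (CKFree E)

namespace GraphCStar

open UniformSpace

variable {E : DirectedGraph.{u}}

instance : NormedAddCommGroup (GraphCStar E) :=
  inferInstanceAs (NormedAddCommGroup (Completion (CKFree E)))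

instance : NormedSpace ℂ (GraphCStar E) :=
  inferInstanceAs (NormedSpace ℂ (Completion (CKFree E)))

instance : CompleteSpace (GraphCStar E) :=
  inferInstanceAs (CompleteSpace (Completion (CKFree E)))

/-- The canonical linear map from the free *-algebra to `C*(E)`. -/
def of : CKFree E →ₗᵢ[ℂ] GraphCStar E := Completion.toComplₗᵢ

theorem denseRange_of : DenseRange (of : CKFree E → GraphCStar E) := Completion.denseRange_coe

/-- Multiplication in `C*(E)`, extended by continuity from the free *-algebra. -/
def mulAux (x y : GraphCStar E) : GraphCStar E :=
  (Completion.isDenseInducing_coe.prodMap Completion.isDenseInducing_coe).extend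
    (fun q : CKFree E × CKFree E => of (q.1 * q.2)) (x, y)

theorem continuous_mulAux : Continuous fun q : GraphCStar E × GraphCStar E => mulAux q.1 q.2 := by
  let m := (AddMonoidHom.mul : CKFree E →+ CKFree E →+ CKFree E).compr₂
    (of : CKFree E →ₗᵢ[ℂ] GraphCStar E).toLinearMap.toAddMonoidHom
  have hm : Continuous fun p : CKFree E × CKFree E => m p.1 p.2 :=
    (of : CKFree E →ₗᵢ[ℂ] GraphCStar E).continuous.comp continuous_mul
  have di : IsDenseInducing (Completion.toCompl : CKFree E → Completion (CKFree E)) :=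
    Completion.isDenseInducing_coe
  exact (di.extend_Z_bilin di hm :)

theorem mulAux_of (x y : CKFree E) : mulAux (of x) (of y) = of (x * y) :=
  (Completion.isDenseInducing_coe.prodMap Completion.isDenseInducing_coe).extend_eq
    ((of : CKFree E →ₗᵢ[ℂ] GraphCStar E).continuous.comp continuous_mul) (x, y)

/-- The involution of `C*(E)`, extended by continuity from the free *-algebra. -/
def starAux : GraphCStar E → GraphCStar E :=
  Completion.map (star : CKFree E → CKFree E)

theorem continuous_starAux : Continuous (starAux : GraphCStar E → GraphCStar E) :=
  Completion.continuous_map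

theorem starAux_of (x : CKFree E) : starAux (of x) = of (star x) :=
  Completion.map_coe (star_isometry.uniformContinuous) x

instance : Mul (GraphCStar E) := ⟨mulAux⟩

instance : ContinuousMul (GraphCStar E) := ⟨continuous_mulAux⟩

instance : Star (GraphCStar E) := ⟨starAux⟩

instance : ContinuousStar (GraphCStar E) := ⟨continuous_starAux⟩

theorem of_mul (x y : CKFree E) : of (x * y) = of x * of y := (mulAux_of x y).symm

theorem of_star (x : CKFree E) : of (star x) = star (of x) := (starAux_of x).symm

theorem of_smul (c : ℂ) (x : CKFree E) : of (c • x) = c • of x :=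
  (of : CKFree E →ₗᵢ[ℂ] GraphCStar E).toLinearMap.map_smul c x

theorem of_add (x y : CKFree E) : of (x + y) = of x + of y :=
  (of : CKFree E →ₗᵢ[ℂ] GraphCStar E).toLinearMap.map_add x y

theorem induction₁ {p : GraphCStar E → Prop} (x : GraphCStar E) (hp : IsClosed {x | p x})
    (h : ∀ x, p (of x)) : p x := denseRange_of.induction_on x hp h

theorem induction₂ {p : GraphCStar E → GraphCStar E → Prop} (x y : GraphCStar E)
    (hp : IsClosed {q : GraphCStar E × GraphCStar E | p q.1 q.2})
    (h : ∀ x y, p (of x) (of y)) : p x y := denseRange_of.induction_on₂ hp h x y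

theorem induction₃ {p : GraphCStar E → GraphCStar E → GraphCStar E → Prop} (x y z : GraphCStar E)
    (hp : IsClosed {q : GraphCStar E × GraphCStar E × GraphCStar E | p q.1 q.2.1 q.2.2})
    (h : ∀ x y z, p (of x) (of y) (of z)) : p x y z := denseRange_of.induction_on₃ hp h x y z

instance : NonUnitalNormedRing (GraphCStar E) :=
  { (inferInstance : NormedAddCommGroup (GraphCStar E)),
    (inferInstance : Mul (GraphCStar E)) with
    left_distrib := fun x y z => by
      induction x, y, z using induction₃ with
      | hp => exact isClosed_eq (by fun_prop) (by fun_prop)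
      | h x y z =>
        simp only [← of_mul, ← of_add, mul_add]
    right_distrib := fun x y z => by
      induction x, y, z using induction₃ with
      | hp => exact isClosed_eq (by fun_prop) (by fun_prop)
      | h x y z =>
        simp only [← of_mul, ← of_add, add_mul]
    zero_mul := fun x => by
      induction x using induction₁ with
      | hp => exact isClosed_eq (by fun_prop) (by fun_prop)
      | h x =>
        rw [← map_zero of, ← of_mul, zero_mul]
    mul_zero := fun x => by
      induction x using induction₁ with
      | hp => exact isClosed_eq (by fun_prop) (by fun_prop)
      | h x =>
        rw [← map_zero of, ← of_mul, mul_zero]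
    mul_assoc := fun x y z => by
      induction x, y, z using induction₃ with
      | hp => exact isClosed_eq (by fun_prop) (by fun_prop)
      | h x y z =>
        simp only [← of_mul, mul_assoc]
    norm_mul_le := fun x y => by
      induction x, y using induction₂ with
      | hp => exact isClosed_le (by fun_prop) (by fun_prop)
      | h x y =>
        rw [← of_mul, of.norm_map, of.norm_map, of.norm_map]
        exact norm_mul_le x y }

instance : StarRing (GraphCStar E) where
  star_involutive x := by
    induction x using induction₁ with
    | hp => exact isClosed_eq (by fun_prop) (by fun_prop)
    | h x =>
      simp only [← of_star, star_star]
  star_mul x y := by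
    induction x, y using induction₂ with
    | hp => exact isClosed_eq (by fun_prop) (by fun_prop)
    | h x y =>
      simp only [← of_star, ← of_mul, star_mul]
  star_add x y := by
    induction x, y using induction₂ with
    | hp => exact isClosed_eq (by fun_prop) (by fun_prop)
    | h x y =>
      simp only [← of_star, ← of_add, star_add]

theorem smul_mul_aux (c : ℂ) (x y : GraphCStar E) : (c • x) * y = c • (x * y) := by
  induction x, y using induction₂ with
  | hp =>
    exact isClosed_eq ((continuous_fst.const_smul c).mul continuous_snd)
      ((continuous_fst.mul continuous_snd).const_smul c)
  | h x y => simp only [← of_mul, ← of_smul, smul_mul_assoc]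

theorem mul_smul_aux (c : ℂ) (x y : GraphCStar E) : c • (x * y) = x * (c • y) := by
  induction x, y using induction₂ with
  | hp =>
    exact isClosed_eq ((continuous_fst.mul continuous_snd).const_smul c)
      (continuous_fst.mul (continuous_snd.const_smul c))
  | h x y => simp only [← of_mul, ← of_smul, mul_smul_comm]

theorem star_smul_aux (c : ℂ) (x : GraphCStar E) : star (c • x) = star c • star x := by
  induction x using induction₁ with
  | hp =>
    exact isClosed_eq (continuous_star.comp (continuous_const_smul c))
      (continuous_star.const_smul (star c))
  | h x => simp only [← of_star, ← of_smul, star_smul]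

instance : NonUnitalCStarAlgebra (GraphCStar E) where
  norm_mul_self_le x := by
    induction x using induction₁ with
    | hp => exact isClosed_le (by fun_prop) (by fun_prop)
    | h x =>
      rw [← of_star, ← of_mul, of.norm_map, of.norm_map]
      exact CKFree.norm_mul_self_le x
  smul_assoc c x y := smul_mul_aux c x y
  smul_comm c x y := mul_smul_aux c x y
  star_smul c x := star_smul_aux c x

/-- The canonical partial isometry `s_e` in `C*(E)`. -/
def isom (e : E.Edge) : GraphCStar E := of (CKFree.iso e)

/-- The canonical projection `p_v` in `C*(E)`. -/
def proj (v : E.Vertex) : GraphCStar E := of (CKFree.proj v)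

theorem isCKFamily : E.IsCKFamily (isom : E.Edge → GraphCStar E) proj := by
  have key : ∀ x y : CKFree E, (∀ p : CKSeminorm E, p.toSeminorm (x - y) = 0) → of x = of y := by
    intro x y h
    rw [← sub_eq_zero, ← map_sub, ← norm_eq_zero, of.norm_map]
    exact le_antisymm (CKFree.univNorm_le fun p => (h p).le) (norm_nonneg _)
  constructor <;> intros <;> simp only [isom, proj, ← of_mul, ← of_star, ← map_sum]
  · exact key _ _ fun p => p.relations.star_proj _
  · exact key _ _ fun p => p.relations.proj_mul_self _
  · rw [← map_zero of]; exact key _ _ fun p => p.relations.proj_orthogonal _ _ ‹_›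
  · rw [← map_zero of]; exact key _ _ fun p => p.relations.range_orthogonal _ _ ‹_›
  · exact key _ _ fun p => p.relations.range_le _
  · exact key _ _ fun p => p.relations.ck1 _
  · exact key _ _ fun p => p.relations.ck2 _ ‹_› ‹_›

section Lift

variable {A : Type w} [NonUnitalCStarAlgebra A]

/-- A Cuntz-Krieger family in a C*-algebra induces a seminorm on the free *-algebra. -/
def seminormOfFamily {S : E.Edge → A} {P : E.Vertex → A} (h : E.IsCKFamily S P) :
    CKSeminorm E :=
  { (normSeminorm ℂ A).comp (CKFree.eval S P h.star_proj : CKFree E →ₗ[ℂ] A) with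
    mul_le' := fun x y => by
      change ‖CKFree.eval S P h.star_proj (x * y)‖ ≤ ‖CKFree.eval S P h.star_proj x‖ *
        ‖CKFree.eval S P h.star_proj y‖
      rw [map_mul]; exact norm_mul_le _ _
    star_mul_self' := fun x => by
      change ‖CKFree.eval S P h.star_proj (star x * x)‖ = ‖CKFree.eval S P h.star_proj x‖ *
        ‖CKFree.eval S P h.star_proj x‖
      rw [map_mul, map_star, CStarRing.norm_star_mul_self]
    relations' := by
      have key : ∀ x y : CKFree E, CKFree.eval S P h.star_proj x = CKFree.eval S P h.star_proj y →
          ‖CKFree.eval S P h.star_proj (x - y)‖ = 0 := fun x y hxy => by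
        rw [map_sub, hxy, sub_self, norm_zero]
      constructor <;> intros <;> refine key _ _ ?_ <;>
        simp only [map_mul, map_star, map_sum, map_zero, CKFree.eval_iso, CKFree.eval_proj]
      · exact h.star_proj _
      · exact h.proj_mul_self _
      · exact h.proj_orthogonal _ _ ‹_›
      · exact h.range_orthogonal _ _ ‹_›
      · exact h.range_le _
      · exact h.ck1 _
      · exact h.ck2 _ ‹_› ‹_› }

theorem norm_eval_le {S : E.Edge → A} {P : E.Vertex → A} (h : E.IsCKFamily S P) (x : CKFree E) :
    ‖CKFree.eval S P h.star_proj x‖ ≤ ‖x‖ :=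
  CKFree.le_univNorm (seminormOfFamily h) x

/-- The universal property of `C*(E)`: existence. -/
def lift {S : E.Edge → A} {P : E.Vertex → A} (h : E.IsCKFamily S P) : GraphCStar E →⋆ₙₐ[ℂ] A :=
  let φ := CKFree.eval S P h.star_proj
  have hu : UniformContinuous φ :=
    AddMonoidHomClass.uniformContinuous_of_bound φ 1 (by simpa using norm_eval_le h)
  let ψ : GraphCStar E → A := Completion.extension φ
  have hψ : Continuous ψ := Completion.continuous_extension
  have hof : ∀ x, ψ (of x) = φ x := Completion.extension_coe hu
  { toFun := ψ
    map_zero' := by rw [← map_zero of, hof, map_zero]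
    map_add' := fun x y => by
      induction x, y using induction₂ with
      | hp => exact isClosed_eq (by fun_prop) (by fun_prop)
      | h x y =>
        rw [← of_add, hof, hof, hof, map_add]
    map_mul' := fun x y => by
      induction x, y using induction₂ with
      | hp => exact isClosed_eq (by fun_prop) (by fun_prop)
      | h x y =>
        simp only [← of_mul, hof, map_mul]
    map_smul' := fun c x => by
      change ψ (c • x) = c • ψ x
      induction x using induction₁ with
      | hp => exact isClosed_eq (hψ.comp (continuous_const_smul c)) (hψ.const_smul c)
      | h x => rw [← of_smul, hof, hof, map_smul]
    map_star' := fun x => by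
      induction x using induction₁ with
      | hp => exact isClosed_eq (by fun_prop) (by fun_prop)
      | h x =>
        simp only [← of_star, hof, map_star] }

theorem lift_of {S : E.Edge → A} {P : E.Vertex → A} (h : E.IsCKFamily S P) (x : CKFree E) :
    lift h (of x) = CKFree.eval S P h.star_proj x :=
  Completion.extension_coe
    (AddMonoidHomClass.uniformContinuous_of_bound _ 1 (by simpa using norm_eval_le h)) x

theorem lift_isom {S : E.Edge → A} {P : E.Vertex → A} (h : E.IsCKFamily S P) (e : E.Edge) :
    lift h (isom e) = S e := by
  rw [isom, lift_of, CKFree.eval_iso]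

theorem lift_proj {S : E.Edge → A} {P : E.Vertex → A} (h : E.IsCKFamily S P) (v : E.Vertex) :
    lift h (proj v) = P v := by
  rw [proj, lift_of, CKFree.eval_proj]

/-- The universal property of `C*(E)`: uniqueness (`C*(E)` is generated by the `s_e` and `p_v`). -/
theorem hom_ext {φ ψ : GraphCStar E →⋆ₙₐ[ℂ] A} (hs : ∀ e, φ (isom e) = ψ (isom e))
    (hp : ∀ v, φ (proj v) = ψ (proj v)) : φ = ψ := by
  have hc : ∀ θ : GraphCStar E →⋆ₙₐ[ℂ] A, Continuous θ := fun θ =>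
    AddMonoidHomClass.continuous_of_bound θ 1 (by
      simpa using NonUnitalStarAlgHom.norm_apply_le θ)
  have := hc φ
  have := hc ψ
  ext x
  induction x using induction₁ with
  | hp => exact isClosed_eq (by fun_prop) (by fun_prop)
  | h x =>
    induction x using CKFree.induction_gen with
    | zero => simp
    | add x y hx hy => simp [hx, hy]
    | smul c x hx => simp [hx]
    | mul x y hx hy => simp [of_mul, hx, hy]
    | iso e => exact hs e
    | star_iso e => rw [of_star, map_star, map_star]; exact congrArg star (hs e)
    | proj v => exact hp v

end Lift

end GraphCStar

/-! ### Actions of the circle and weighted gauge actions -/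

/-- A (strongly continuous) action of the circle group on a C*-algebra by *-automorphisms. -/
structure CircleAction (A : Type u) [NonUnitalCStarAlgebra A] where
  toHom : Circle →* (A ≃⋆ₐ[ℂ] A)
  continuous_apply : ∀ a, Continuous fun z => toHom z a

namespace GraphCStar

variable {E : DirectedGraph.{u}}

theorem isCKFamily_gauge (f : E.Edge → ℤ) (z : Circle) :
    E.IsCKFamily (fun e => ((z ^ f e : Circle) : ℂ) • (isom e : GraphCStar E)) proj := by
  have h : E.IsCKFamily (isom : E.Edge → GraphCStar E) proj := isCKFamily
  have hz : ∀ w : Circle, star (w : ℂ) * (w : ℂ) = 1 := fun w => by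
    have := Complex.conj_mul' (w : ℂ)
    rw [Circle.norm_coe] at this
    simpa using this
  have hz' : ∀ w : Circle, (w : ℂ) * star (w : ℂ) = 1 := fun w => by rw [mul_comm, hz]
  constructor
  · exact h.star_proj
  · exact h.proj_mul_self
  · exact h.proj_orthogonal
  · intro e e' he
    rw [star_smul, smul_mul_smul_comm, h.range_orthogonal e e' he, smul_zero]
  · intro e
    rw [mul_smul_comm, h.range_le]
  · intro e
    rw [star_smul, smul_mul_smul_comm, hz, one_smul, h.ck1]
  · intro v hv hs
    rw [h.ck2 v hv hs]
    refine Finset.sum_congr rfl fun e _ => ?_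
    rw [star_smul, smul_mul_smul_comm, hz', one_smul]

/-- The endomorphism of `C*(E)` with `s_e ↦ z ^ f(e) s_e` and `p_v ↦ p_v`. -/
def gaugeHom (f : E.Edge → ℤ) (z : Circle) : GraphCStar E →⋆ₙₐ[ℂ] GraphCStar E :=
  lift (isCKFamily_gauge f z)

theorem gaugeHom_isom (f : E.Edge → ℤ) (z : Circle) (e : E.Edge) :
    gaugeHom f z (isom e) = ((z ^ f e : Circle) : ℂ) • isom e := lift_isom _ e

theorem gaugeHom_proj (f : E.Edge → ℤ) (z : Circle) (v : E.Vertex) :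
    gaugeHom f z (proj v) = proj v := lift_proj _ v

theorem gaugeHom_mul (f : E.Edge → ℤ) (z w : Circle) (x : GraphCStar E) :
    gaugeHom f (z * w) x = gaugeHom f z (gaugeHom f w x) := by
  have : gaugeHom f (z * w) = (gaugeHom f z).comp (gaugeHom f w) := by
    refine hom_ext (fun e => ?_) (fun v => ?_)
    · rw [NonUnitalStarAlgHom.comp_apply, gaugeHom_isom, gaugeHom_isom, map_smul, gaugeHom_isom,
        smul_smul, mul_zpow, mul_comm, Circle.coe_mul]
    · rw [NonUnitalStarAlgHom.comp_apply, gaugeHom_proj, gaugeHom_proj, gaugeHom_proj]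
  exact DFunLike.congr_fun this x

theorem gaugeHom_one (f : E.Edge → ℤ) (x : GraphCStar E) : gaugeHom f 1 x = x := by
  have : gaugeHom f 1 = NonUnitalStarAlgHom.id ℂ (GraphCStar E) := by
    refine hom_ext (fun e => ?_) (fun v => ?_)
    · rw [gaugeHom_isom, one_zpow, Circle.coe_one, one_smul]; rfl
    · rw [gaugeHom_proj]; rfl
  exact DFunLike.congr_fun this x

theorem continuous_gaugeHom (f : E.Edge → ℤ) (x : GraphCStar E) :
    Continuous fun z => gaugeHom f z x := by
  have hle : ∀ z (y : GraphCStar E), ‖gaugeHom f z y‖ ≤ ‖y‖ := fun z y =>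
    NonUnitalStarAlgHom.norm_apply_le _ y
  have hof : ∀ y : CKFree E, Continuous fun z => gaugeHom f z (of y) := by
    intro y
    induction y using CKFree.induction_gen with
    | zero => simpa using continuous_const
    | add x y hx hy => simp only [map_add]; exact hx.add hy
    | smul c x hx => simp only [map_smul]; exact hx.const_smul c
    | mul x y hx hy => simp only [of_mul, map_mul]; exact hx.mul hy
    | iso e =>
      change Continuous fun z => gaugeHom f z (isom e)
      simp only [gaugeHom_isom]
      have : Continuous fun z : Circle => ((z ^ f e : Circle) : ℂ) :=
        continuous_subtype_val.comp (continuous_zpow (f e))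
      exact this.smul continuous_const
    | star_iso e =>
      simp only [of_star, map_star]
      refine Continuous.star ?_
      change Continuous fun z => gaugeHom f z (isom e)
      simp only [gaugeHom_isom]
      have : Continuous fun z : Circle => ((z ^ f e : Circle) : ℂ) :=
        continuous_subtype_val.comp (continuous_zpow (f e))
      exact this.smul continuous_const
    | proj v =>
      change Continuous fun z => gaugeHom f z (proj v)
      simpa only [gaugeHom_proj] using continuous_const
  refine continuous_of_uniform_approx_of_continuous (fun u hu => ?_)
  obtain ⟨ε, hε, hu⟩ := Metric.mem_uniformity_dist.1 hu
  obtain ⟨y, hy⟩ := Metric.denseRange_iff.1 (denseRange_of (E := E)) x ε hε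
  refine ⟨fun z => gaugeHom f z (of y), hof y, fun z => hu ?_⟩
  rw [dist_eq_norm, ← map_sub]
  rw [dist_eq_norm] at hy
  exact (hle z _).trans_lt hy

/-- The weighted gauge action on `C*(E)` with edge function `f`:
`γ_z(s_e) = z ^ f(e) s_e` and `γ_z(p_v) = p_v`. -/
def gaugeAction (E : DirectedGraph.{u}) (f : E.Edge → ℤ) : CircleAction (GraphCStar E) where
  toHom :=
    { toFun := fun z =>
        { gaugeHom f z with
          invFun := gaugeHom f z⁻¹
          left_inv := fun x => by
            change gaugeHom f z⁻¹ (gaugeHom f z x) = x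
            rw [← gaugeHom_mul, inv_mul_cancel, gaugeHom_one]
          right_inv := fun x => by
            change gaugeHom f z (gaugeHom f z⁻¹ x) = x
            rw [← gaugeHom_mul, mul_inv_cancel, gaugeHom_one]
          map_smul' := fun c x => map_smul (gaugeHom f z) c x }
      map_one' := StarAlgEquiv.ext fun x => gaugeHom_one f x
      map_mul' := fun z w => StarAlgEquiv.ext fun x => gaugeHom_mul f z w x }
  continuous_apply := fun x => continuous_gaugeHom f x

theorem gaugeAction_apply (f : E.Edge → ℤ) (z : Circle) (x : GraphCStar E) :
    (gaugeAction E f).toHom z x = gaugeHom f z x := rfl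

end GraphCStar

/-! ### The diagonal subalgebra -/

/-- Finite paths `e₁ ⋯ eₙ` with `s(eᵢ) = r(eᵢ₊₁)`, including the vertices as paths of length zero;
`FinitePath E v w` are the paths with range `v` and source `w`. -/
inductive FinitePath (E : DirectedGraph.{u}) : E.Vertex → E.Vertex → Type u
  | vertex (v : E.Vertex) : FinitePath E v v
  | cons (e : E.Edge) {w : E.Vertex} (μ : FinitePath E (E.s e) w) : FinitePath E (E.r e) w

namespace GraphCStar

/-- `s_μ = s_{e₁} ⋯ s_{eₙ}` for a path `μ = e₁ ⋯ eₙ`, and `s_v = p_v` for a vertex `v`. -/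
def path {E : DirectedGraph.{u}} {v w : E.Vertex} : FinitePath E v w → GraphCStar E
  | FinitePath.vertex v => proj v
  | FinitePath.cons e μ => isom e * path μ

/-- The diagonal subalgebra `D(E)`: the C*-subalgebra of `C*(E)` generated by the projections
`s_μ s_μ*`, where `μ` runs over the finite paths. -/
def diagonal (E : DirectedGraph.{u}) : NonUnitalStarSubalgebra ℂ (GraphCStar E) :=
  (NonUnitalStarAlgebra.adjoin ℂ
    {x : GraphCStar E | ∃ (v w : E.Vertex) (μ : FinitePath E v w),
      x = path μ * star (path μ)}).topologicalClosure

end GraphCStar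

/-! ### Out-splits -/

/-- The data of an out-split of `E`. For each vertex `v` that is not a source, the set `s⁻¹(v)` is
partitioned into `m v` nonempty blocks, where `block e` is the number (counted from `0`) of the
block that contains `e`; so `m v = 0` if `s⁻¹(v)` is empty. Also `m v = 0` if `v` is a source, and
the set `s⁻¹(v)` is not partitioned then (the values of `block` there play no role).
Infinitely many blocks are allowed. -/
structure OutSplitting (E : DirectedGraph.{u}) where
  m : E.Vertex → ℕ∞
  block : E.Edge → ℕ
  m_of_isSource : ∀ v, E.IsSource v → m v = 0
  block_lt : ∀ e, ¬ E.IsSource (E.s e) → (block e : ℕ∞) < m (E.s e)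
  block_nonempty : ∀ (v : E.Vertex) (i : ℕ), (i : ℕ∞) < m v → ∃ e, E.s e = v ∧ block e = i

namespace OutSplitting

variable {E : DirectedGraph.{u}}

/-- Infinite receivers are not split. -/
def Proper (P : OutSplitting E) : Prop :=
  ∀ v : E.Vertex, (E.r ⁻¹' {v}).Infinite → P.m v = 1

/-- The vertices of the out-split graph: copies `v^i` for `i < m v`, and `v` itself if
`m v = 0`. -/
inductive Vertex (P : OutSplitting E) : Type u
  | copy (v : E.Vertex) (i : ℕ) (hi : (i : ℕ∞) < P.m v)
  | whole (v : E.Vertex) (h : P.m v = 0)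

/-- The edges of the out-split graph: copies `e^i` for `i < m (r e)`, and `e` itself if
`m (r e) = 0`. -/
inductive Edge (P : OutSplitting E) : Type u
  | copy (e : E.Edge) (i : ℕ) (hi : (i : ℕ∞) < P.m (E.r e))
  | whole (e : E.Edge) (h : P.m (E.r e) = 0)

/-- The vertex of the out-split graph from which every copy of the edge `e` is emitted: `s(e)^i`
if `e` lies in the `i`-th block of `s⁻¹(s(e))`, or `s(e)` itself if it is not split. -/
def sourceVertex (P : OutSplitting E) (e : E.Edge) : P.Vertex :=
  open Classical in
  if h : P.m (E.s e) = 0 then Vertex.whole (E.s e) h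
  else Vertex.copy (E.s e) (P.block e)
    (P.block_lt e fun hs => h (P.m_of_isSource (E.s e) hs))

/-- The range map of the out-split graph. -/
def range (P : OutSplitting E) : P.Edge → P.Vertex
  | Edge.copy e i hi => Vertex.copy (E.r e) i hi
  | Edge.whole e h => Vertex.whole (E.r e) h

/-- The source map of the out-split graph. -/
def source (P : OutSplitting E) : P.Edge → P.Vertex
  | Edge.copy e _ _ => P.sourceVertex e
  | Edge.whole e _ => P.sourceVertex e

theorem countable_vertex (P : OutSplitting E) : Countable P.Vertex := by
  have := E.countable_vertex
  let φ : P.Vertex → E.Vertex × Option ℕ := fun x => match x with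
    | Vertex.copy v i _ => (v, some i)
    | Vertex.whole v _ => (v, none)
  refine Function.Injective.countable (f := φ) fun x y h => ?_
  cases x <;> cases y <;> simp_all [φ]

theorem countable_edge (P : OutSplitting E) : Countable P.Edge := by
  have := E.countable_edge
  let φ : P.Edge → E.Edge × Option ℕ := fun x => match x with
    | Edge.copy v i _ => (v, some i)
    | Edge.whole v _ => (v, none)
  refine Function.Injective.countable (f := φ) fun x y h => ?_
  cases x <;> cases y <;> simp_all [φ]

/-- The out-split graph. -/
def graph (P : OutSplitting E) : DirectedGraph.{u} where
  Vertex := P.Vertex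
  Edge := P.Edge
  r := P.range
  s := P.source
  countable_vertex := P.countable_vertex
  countable_edge := P.countable_edge

end OutSplitting

/-! ### Morita equivalence of triples -/

/-- A projection `P` in the multiplier algebra of `C` is full if `C P C` spans a dense subspace of
`C`. Here `P.fst c` is the product `P c`. -/
def IsFullProjection {C : Type u} [NonUnitalCStarAlgebra C] (P : DoubleCentralizer ℂ C) : Prop :=
  IsStarProjection P ∧
    Dense (Submodule.span ℂ {x : C | ∃ a b : C, x = a * P.fst b} : Set C)

/-- The corner `P C P`. Here `P.snd c` is the product `c P`. -/
def corner {C : Type u} [NonUnitalCStarAlgebra C] (P : DoubleCentralizer ℂ C) : Set C :=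
  Set.range fun c : C => P.fst (P.snd c)

/-- The normalisers of a subalgebra `D`. -/
def normalizers {C : Type u} [NonUnitalCStarAlgebra C] (D : NonUnitalStarSubalgebra ℂ C) : Set C :=
  {n : C | ∀ d ∈ D, n * d * star n ∈ D ∧ star n * d * n ∈ D}

/-- A diagonal subalgebra: a commutative C*-subalgebra whose normalisers span a dense subspace. -/
structure IsDiagonal {C : Type u} [NonUnitalCStarAlgebra C] (D : NonUnitalStarSubalgebra ℂ C) :
    Prop where
  isClosed : IsClosed (D : Set C)
  comm : ∀ x ∈ D, ∀ y ∈ D, x * y = y * x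
  regular : Dense (Submodule.span ℂ (normalizers D) : Set C)

/-- The conditions on `C`, `P₁`, `P₂`, `π₁`, `π₂`, `γ`, `D` in the definition of Morita equivalence
of the triples `(A₁, α₁, D₁)` and `(A₂, α₂, D₂)`. An isomorphism of `Aᵢ` onto the corner `Pᵢ C Pᵢ`
is given as an injective *-homomorphism into `C` whose image is that corner. -/
structure IsMoritaLink {A₁ A₂ C : Type u} [NonUnitalCStarAlgebra A₁] [NonUnitalCStarAlgebra A₂]
    [NonUnitalCStarAlgebra C] (α₁ : CircleAction A₁) (D₁ : NonUnitalStarSubalgebra ℂ A₁)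
    (α₂ : CircleAction A₂) (D₂ : NonUnitalStarSubalgebra ℂ A₂)
    (P₁ P₂ : DoubleCentralizer ℂ C) (π₁ : A₁ →⋆ₙₐ[ℂ] C) (π₂ : A₂ →⋆ₙₐ[ℂ] C)
    (γ : CircleAction C) (D : NonUnitalStarSubalgebra ℂ C) : Prop where
  full₁ : IsFullProjection P₁
  full₂ : IsFullProjection P₂
  complementary : P₁ + P₂ = 1
  injective₁ : Function.Injective π₁
  injective₂ : Function.Injective π₂
  range₁ : Set.range π₁ = corner P₁
  range₂ : Set.range π₂ = corner P₂
  equivariant₁ : ∀ (z : Circle) (a : A₁), π₁ (α₁.toHom z a) = γ.toHom z (π₁ a)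
  equivariant₂ : ∀ (z : Circle) (a : A₂), π₂ (α₂.toHom z a) = γ.toHom z (π₂ a)
  isDiagonal : IsDiagonal D
  diagonal₁ : π₁ '' (D₁ : Set A₁) = P₁.fst '' (D : Set C)
  diagonal₂ : π₂ '' (D₂ : Set A₂) = P₂.fst '' (D : Set C)

/-- Morita equivalence of the triples `(A₁, α₁, D₁)` and `(A₂, α₂, D₂)`, each consisting of a
C*-algebra, an action of the circle and a subalgebra. -/
def MoritaEquivalent {A₁ A₂ : Type u} [NonUnitalCStarAlgebra A₁] [NonUnitalCStarAlgebra A₂]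
    (α₁ : CircleAction A₁) (D₁ : NonUnitalStarSubalgebra ℂ A₁)
    (α₂ : CircleAction A₂) (D₂ : NonUnitalStarSubalgebra ℂ A₂) : Prop :=
  ∃ (C : Type u) (_ : NonUnitalCStarAlgebra C) (P₁ P₂ : DoubleCentralizer ℂ C)
    (π₁ : A₁ →⋆ₙₐ[ℂ] C) (π₂ : A₂ →⋆ₙₐ[ℂ] C) (γ : CircleAction C)
    (D : NonUnitalStarSubalgebra ℂ C),
    IsMoritaLink α₁ D₁ α₂ D₂ P₁ P₂ π₁ π₂ γ D

end

/-!
The copies `v^i` of a vertex all receive copies of the same edges, and the vertex that emits a copy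
of an edge `e` depends on `e` only. So the projection of the out-split graph onto `E` has unique
lifting of edges with prescribed range, and the projections `p_{v^i}`, for a fixed `v`, are
equivalent in the algebra `A` of the out-split graph: the partial isometry
`U = ∑ s_{e^0} s_{e^i}*`, summed over the finitely many edges `e` with range `v`, carries `p_{v^i}`
to `p_{v^0}` (`OutSplitting.transfer`). A source has a single copy, where `U` is the vertex
projection. Thus `A` is an amplification of `C*(E)` in which `p_v` is repeated once for each copy.

Accordingly `p_v ↦ p_{v^0}` and `s_e ↦ s_{e^0} U*` define a homomorphism from `C*(E)` to `A`
(`OutSplitting.cornerHom`). It is equivariant if every copy of `e` gets the weight `f e`. Its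
image is the hereditary subalgebra cut out by the copies with number `0`, as
`U a W*` lies in the image for all `a` and all transfer elements `U`, `W`
(`OutSplitting.transfer_mul_mul_star_transfer_mem`), and it is full since `U* U` is the projection
of the copy. Lifting and projecting paths shows that it matches the diagonals.

Injectivity would follow from a representation of `A` in `C*(E) ⊗ K` with the number of the copy as
matrix index. There may be infinitely many copies, but finite matrices are enough: the truncated
representations satisfy each Cuntz-Krieger relation from some size on, so the limit of their
norms along an ultrafilter is a C*-seminorm of the kind that defines the norm of `A`
(`CKSeminorm.exists_of_asymptotic`), and it restricts to the norm of `C*(E)`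
(`OutSplitting.norm_cornerHom`).

Finally, an equivariant embedding as a full hereditary corner that respects the diagonals gives a
Morita equivalence of triples (`IsFullDiagonalCorner.moritaEquivalent`), witnessed by the linking
algebra of `2 × 2` matrices over `A` with the diagonal matrices over the two diagonals. The
normalisers of these span a dense subspace because each corner is the closed span of normalisers of
the diagonal of `A`, cut down by vertex projections, or of images of normalisers of the diagonal of
`C*(E)`.
-/

noncomputable section

/-! ### Closed spans, normalisers and entries of matrices -/

/-- A closed subspace contains the closed span of any of its subsets. -/
theorem Submodule.topologicalClosure_span_le {V : Type*} [NormedAddCommGroup V]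
    [NormedSpace ℂ V] {s : Set V} {T : Submodule ℂ V} (hT : IsClosed (T : Set V)) (h : s ⊆ T) :
    (Submodule.span ℂ s).topologicalClosure ≤ T :=
  Submodule.topologicalClosure_minimal _ (Submodule.span_le.2 h) hT

/-- A closed subspace that contains a set with dense span is everything. -/
theorem Submodule.mem_of_dense_span {V : Type*} [NormedAddCommGroup V]
    [NormedSpace ℂ V] {s : Set V} {T : Submodule ℂ V} (hs : Dense (Submodule.span ℂ s : Set V))
    (hT : IsClosed (T : Set V)) (h : s ⊆ T) (x : V) : x ∈ T :=
  Submodule.topologicalClosure_span_le hT h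
    (by rw [(Submodule.dense_iff_topologicalClosure_eq_top).1 hs]; trivial)

theorem NonUnitalStarAlgHom.continuous' {A B : Type*} [NonUnitalCStarAlgebra A]
    [NonUnitalCStarAlgebra B] (φ : A →⋆ₙₐ[ℂ] B) : Continuous φ :=
  AddMonoidHomClass.continuous_of_bound φ 1 (by simpa using NonUnitalStarAlgHom.norm_apply_le φ)

theorem star_mem_normalizers {C : Type u} [NonUnitalCStarAlgebra C]
    {D : NonUnitalStarSubalgebra ℂ C} {n : C} (hn : n ∈ normalizers D) :
    star n ∈ normalizers D := fun d hd => by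
  rw [star_star]
  exact (hn d hd).symm

theorem mul_mem_normalizers {C : Type u} [NonUnitalCStarAlgebra C]
    {D : NonUnitalStarSubalgebra ℂ C} {m n : C} (hm : m ∈ normalizers D)
    (hn : n ∈ normalizers D) : m * n ∈ normalizers D := fun d hd => by
  have h1 := (hm _ (hn d hd).1).1
  have h2 := (hn _ (hm d hd).2).2
  simp only [star_mul, mul_assoc] at h1 h2 ⊢
  exact ⟨h1, h2⟩

theorem CStarMatrix.continuous_entry {A : Type*} [NonUnitalCStarAlgebra A] [PartialOrder A]
    [StarOrderedRing A] (i j : Fin 2) :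
    Continuous fun M : CStarMatrix (Fin 2) (Fin 2) A => M i j :=
  (continuous_apply j).comp (continuous_apply (A := fun _ => Fin 2 → A) i)

theorem CStarMatrix.continuous_of_entries {A X : Type*} [NonUnitalCStarAlgebra A] [PartialOrder A]
    [StarOrderedRing A] [TopologicalSpace X] {F : X → CStarMatrix (Fin 2) (Fin 2) A}
    (hF : ∀ i j, Continuous fun x => F x i j) : Continuous F :=
  continuous_pi fun i => continuous_pi fun j => hF i j

/-! ### Linking algebras of diagonal-preserving full corners -/

/-- An embedding `φ` of `A₁` in `A₂` as a full corner, compatible with circle actions and with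
diagonal subalgebras. The projection that cuts out the corner is the strict sum of the `φ (p i)`
and need not lie in `A₂`; it enters only through the `p i`. -/
structure IsFullDiagonalCorner {A₁ A₂ : Type u} {ι : Type w} [NonUnitalCStarAlgebra A₁]
    [NonUnitalCStarAlgebra A₂] (α₁ : CircleAction A₁) (D₁ : NonUnitalStarSubalgebra ℂ A₁)
    (α₂ : CircleAction A₂) (D₂ : NonUnitalStarSubalgebra ℂ A₂) (φ : A₁ →⋆ₙₐ[ℂ] A₂)
    (p : ι → A₁) : Prop where
  injective : Function.Injective φ
  equivariant : ∀ (z : Circle) (a : A₁), φ (α₁.toHom z a) = α₂.toHom z (φ a)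
  star_proj : ∀ i, star (p i) = p i
  proj_mul_self : ∀ i, p i * p i = p i
  proj_mem : ∀ i, p i ∈ D₁
  proj_fixed : ∀ i z, α₁.toHom z (p i) = p i
  dense_proj : Dense (Submodule.span ℂ {x : A₁ | ∃ i a, x = p i * a} : Set A₁)
  hereditary : ∀ i j (b : A₂), ∃ a, φ a = φ (p i) * b * φ (p j)
  full : Dense (Submodule.span ℂ {x : A₂ | ∃ i b c, x = b * φ (p i) * c} : Set A₂)
  isDiagonal₁ : IsDiagonal D₁
  isDiagonal₂ : IsDiagonal D₂
  map_diagonal : ∀ d ∈ D₁, φ d ∈ D₂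
  compress_diagonal : ∀ i, ∀ d ∈ D₂, ∃ d' ∈ D₁, φ d' = φ (p i) * d * φ (p i)

namespace IsFullDiagonalCorner

variable {A₁ A₂ : Type u} {ι : Type w} [NonUnitalCStarAlgebra A₁] [NonUnitalCStarAlgebra A₂]

/-- The closed right ideal of `A₂` generated by the `φ (p i)`: the off-diagonal corner of the
linking algebra. -/
def offDiag (φ : A₁ →⋆ₙₐ[ℂ] A₂) (p : ι → A₁) : Submodule ℂ A₂ :=
  (Submodule.span ℂ {x : A₂ | ∃ i b, x = φ (p i) * b}).topologicalClosure

theorem isClosed_offDiag (φ : A₁ →⋆ₙₐ[ℂ] A₂) (p : ι → A₁) :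
    IsClosed (offDiag φ p : Set A₂) := Submodule.isClosed_topologicalClosure _

theorem map_proj_mul_mem (φ : A₁ →⋆ₙₐ[ℂ] A₂) (p : ι → A₁) (i : ι) (b : A₂) :
    φ (p i) * b ∈ offDiag φ p :=
  Submodule.le_topologicalClosure _ (Submodule.subset_span ⟨i, b, rfl⟩)

variable {φ : A₁ →⋆ₙₐ[ℂ] A₂} {p : ι → A₁}

theorem mul_mem_offDiag {x : A₂} (hx : x ∈ offDiag φ p) (b : A₂) : x * b ∈ offDiag φ p := by
  have : offDiag φ p ≤ (offDiag φ p).comap (LinearMap.mulRight ℂ b) :=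
    Submodule.topologicalClosure_span_le
      ((isClosed_offDiag φ p).preimage (continuous_mul_const b)) (by
        rintro _ ⟨i, c, rfl⟩
        change φ (p i) * c * b ∈ offDiag φ p
        rw [mul_assoc]
        exact map_proj_mul_mem φ p i _)
  exact this hx

variable {α₁ : CircleAction A₁} {D₁ : NonUnitalStarSubalgebra ℂ A₁}
  {α₂ : CircleAction A₂} {D₂ : NonUnitalStarSubalgebra ℂ A₂}

section

variable (h : IsFullDiagonalCorner α₁ D₁ α₂ D₂ φ p)
include h

theorem map_mem_offDiag (a : A₁) : φ a ∈ offDiag φ p :=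
  Submodule.mem_of_dense_span (T := (offDiag φ p).comap (φ : A₁ →ₗ[ℂ] A₂)) h.dense_proj
    ((isClosed_offDiag φ p).preimage φ.continuous') (by
      rintro _ ⟨i, a, rfl⟩
      change φ (p i * a) ∈ offDiag φ p
      rw [map_mul]
      exact map_proj_mul_mem φ p i _) a

theorem isClosed_range : IsClosed (NonUnitalStarAlgHom.range φ : Set A₂) := by
  have := (NonUnitalStarAlgHom.isometry φ h.injective).isClosedEmbedding.isClosed_range
  simpa using this

theorem isClosed_map : IsClosed (φ '' (D₁ : Set A₁)) :=
  (NonUnitalStarAlgHom.isometry φ h.injective).isClosedEmbedding.isClosedMap _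
    h.isDiagonal₁.isClosed

/-- The product of the off-diagonal corner with its adjoint lies in `φ(A₁)`: this is where the
image is required to be hereditary. -/
theorem mul_star_mem_range {x y : A₂} (hx : x ∈ offDiag φ p) (hy : y ∈ offDiag φ p) :
    x * star y ∈ NonUnitalStarAlgHom.range φ := by
  let R : Submodule ℂ A₂ := (NonUnitalStarAlgHom.range φ).toNonUnitalSubalgebra.toSubmodule
  have hR : IsClosed (R : Set A₂) := h.isClosed_range
  have key : ∀ i b, ∀ y ∈ offDiag φ p, y * star (φ (p i) * b) ∈ R := by
    intro i b
    have : offDiag φ p ≤ R.comap (LinearMap.mulRight ℂ (star (φ (p i) * b))) :=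
      Submodule.topologicalClosure_span_le (hR.preimage (continuous_mul_const _)) (by
        rintro _ ⟨j, c, rfl⟩
        change φ (p j) * c * star (φ (p i) * b) ∈ R
        obtain ⟨a, ha⟩ := h.hereditary j i (c * star b)
        refine ⟨a, ha.trans ?_⟩
        rw [star_mul, ← map_star, h.star_proj]
        simp only [mul_assoc])
    exact this
  have : offDiag φ p ≤ R.comap (LinearMap.mulRight ℂ (star x)) :=
    Submodule.topologicalClosure_span_le (hR.preimage (continuous_mul_const _)) (by
      rintro _ ⟨j, c, rfl⟩
      change φ (p j) * c * star x ∈ NonUnitalStarAlgHom.range φ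
      have := star_mem (show x * star (φ (p j) * c) ∈ NonUnitalStarAlgHom.range φ from key j c x hx)
      rwa [star_mul, star_star] at this)
  have := star_mem
    (show y * star x ∈ NonUnitalStarAlgHom.range φ from this hy)
  rwa [star_mul, star_star] at this

theorem action_mem_offDiag (z : Circle) {x : A₂} (hx : x ∈ offDiag φ p) :
    α₂.toHom z x ∈ offDiag φ p := by
  have hc : Continuous (α₂.toHom z) := (NonUnitalStarAlgHomClass.toNonUnitalStarAlgHom
    (α₂.toHom z) : A₂ →⋆ₙₐ[ℂ] A₂).continuous'
  have : offDiag φ p ≤ (offDiag φ p).comap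
      (NonUnitalStarAlgHomClass.toNonUnitalStarAlgHom (α₂.toHom z) : A₂ →ₗ[ℂ] A₂) :=
    Submodule.topologicalClosure_span_le ((isClosed_offDiag φ p).preimage hc) (by
      rintro _ ⟨i, c, rfl⟩
      change α₂.toHom z (φ (p i) * c) ∈ offDiag φ p
      rw [map_mul, ← h.equivariant, h.proj_fixed]
      exact map_proj_mul_mem φ p i _)
  exact this hx

theorem action_mem_range (z : Circle) {x : A₂} (hx : x ∈ NonUnitalStarAlgHom.range φ) :
    α₂.toHom z x ∈ NonUnitalStarAlgHom.range φ := by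
  obtain ⟨a, rfl⟩ := hx
  exact ⟨α₁.toHom z a, h.equivariant z a⟩

end

section Linking

/-- The linking algebra: the `2 × 2` matrices over `A₂` whose entries lie in `φ(A₁)`, in the right
ideal `offDiag φ p`, in its adjoint, and in `A₂`. -/
def linking (h : IsFullDiagonalCorner α₁ D₁ α₂ D₂ φ p) :
    NonUnitalStarSubalgebra ℂ (CStarMatrix (Fin 2) (Fin 2) A₂) where
  carrier := {M | M 0 0 ∈ NonUnitalStarAlgHom.range φ ∧ M 0 1 ∈ offDiag φ p ∧
    star (M 1 0) ∈ offDiag φ p}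
  add_mem' := fun hM hN => ⟨add_mem hM.1 hN.1, add_mem hM.2.1 hN.2.1, by
    rw [CStarMatrix.add_apply, star_add]; exact add_mem hM.2.2 hN.2.2⟩
  zero_mem' := ⟨zero_mem _, zero_mem _, by simp⟩
  smul_mem' := fun c M hM => ⟨SMulMemClass.smul_mem c hM.1, Submodule.smul_mem _ c hM.2.1, by
    rw [CStarMatrix.smul_apply, star_smul]; exact Submodule.smul_mem _ _ hM.2.2⟩
  star_mem' := fun {M} hM => by
    refine ⟨star_mem hM.1, hM.2.2, ?_⟩
    change star (star (M 0 1)) ∈ _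
    rw [star_star]
    exact hM.2.1
  mul_mem' := fun {M N} hM hN => by
    have hr : ∀ {x y}, x ∈ NonUnitalStarAlgHom.range φ → x * y ∈ offDiag φ p := by
      rintro _ y ⟨a, rfl⟩
      exact mul_mem_offDiag (h.map_mem_offDiag a) y
    refine ⟨?_, ?_, ?_⟩ <;>
      simp only [CStarMatrix.mul_apply, Fin.sum_univ_two, star_add, star_mul]
    · refine add_mem (mul_mem hM.1 hN.1) ?_
      have := h.mul_star_mem_range hM.2.1 hN.2.2
      rwa [star_star] at this
    · exact add_mem (hr hM.1) (mul_mem_offDiag hM.2.1 _)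
    · exact add_mem (hr (star_mem hN.1)) (mul_mem_offDiag hN.2.2 _)

variable (h : IsFullDiagonalCorner α₁ D₁ α₂ D₂ φ p)

theorem linking_ext {M N : h.linking} (h00 : M.1 0 0 = N.1 0 0) (h01 : M.1 0 1 = N.1 0 1)
    (h10 : M.1 1 0 = N.1 1 0) (h11 : M.1 1 1 = N.1 1 1) : M = N := by
  refine Subtype.ext (CStarMatrix.ext fun i j => ?_)
  fin_cases i <;> fin_cases j <;> assumption

/-- The element of the linking algebra with the given entries; the last off-diagonal entry is the
adjoint of an element of `offDiag φ p`. -/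
def entries (a : A₁) (x y : offDiag φ p) (b : A₂) : h.linking :=
  ⟨CStarMatrix.ofMatrix !![φ a, x; star (y : A₂), b], ⟨a, rfl⟩, x.2, by simp⟩

variable [PartialOrder A₂] [StarOrderedRing A₂]

instance isClosed_linking : IsClosed (h.linking : Set (CStarMatrix (Fin 2) (Fin 2) A₂)) :=
  (h.isClosed_range.preimage (CStarMatrix.continuous_entry 0 0)).inter
    (((isClosed_offDiag φ p).preimage (CStarMatrix.continuous_entry 0 1)).inter
      ((isClosed_offDiag φ p).preimage (continuous_star.comp (CStarMatrix.continuous_entry 1 0))))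

end Linking

end IsFullDiagonalCorner

/-! ### Multipliers, action and diagonal of the linking algebra -/

namespace IsFullDiagonalCorner

variable {A₁ A₂ : Type u} {ι : Type w} [NonUnitalCStarAlgebra A₁] [NonUnitalCStarAlgebra A₂]
  {φ : A₁ →⋆ₙₐ[ℂ] A₂} {p : ι → A₁} {α₁ : CircleAction A₁} {D₁ : NonUnitalStarSubalgebra ℂ A₁}
  {α₂ : CircleAction A₂} {D₂ : NonUnitalStarSubalgebra ℂ A₂}
  (h : IsFullDiagonalCorner α₁ D₁ α₂ D₂ φ p)

section Entries

variable {h}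

@[simp] theorem entries_zero_zero (a : A₁) (x y : offDiag φ p) (b : A₂) :
    (h.entries a x y b).1 0 0 = φ a := rfl

@[simp] theorem entries_zero_one (a : A₁) (x y : offDiag φ p) (b : A₂) :
    (h.entries a x y b).1 0 1 = x := rfl

@[simp] theorem entries_one_zero (a : A₁) (x y : offDiag φ p) (b : A₂) :
    (h.entries a x y b).1 1 0 = star (y : A₂) := rfl

@[simp] theorem entries_one_one (a : A₁) (x y : offDiag φ p) (b : A₂) :
    (h.entries a x y b).1 1 1 = b := rfl

theorem mul_entry (M N : h.linking) (i j : Fin 2) :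
    (M * N).1 i j = M.1 i 0 * N.1 0 j + M.1 i 1 * N.1 1 j := by
  change (M.1 * N.1) i j = _
  simp [CStarMatrix.mul_apply]

theorem star_entry (M : h.linking) (i j : Fin 2) : (star M).1 i j = star (M.1 j i) := rfl

theorem add_entry (M N : h.linking) (i j : Fin 2) : (M + N).1 i j = M.1 i j + N.1 i j := rfl

theorem smul_entry (c : ℂ) (M : h.linking) (i j : Fin 2) : (c • M).1 i j = c • M.1 i j := rfl

theorem zero_entry (i j : Fin 2) : (0 : h.linking).1 i j = 0 := rfl

theorem exists_entries (M : h.linking) :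
    ∃ a x y b, M = h.entries a x 0 0 + h.entries 0 0 y b := by
  obtain ⟨a, ha⟩ := M.2.1
  refine ⟨a, ⟨_, M.2.2.1⟩, ⟨_, M.2.2.2⟩, M.1 1 1, linking_ext _ ?_ ?_ ?_ ?_⟩
  · rw [add_entry]
    simpa using (show φ a = M.1 0 0 from ha).symm
  all_goals rw [add_entry]; simp

end Entries

/-- The embedding of `A₁` as the upper left corner. -/
def inclUpper : A₁ →⋆ₙₐ[ℂ] h.linking where
  toFun a := h.entries a 0 0 0
  map_smul' c a := by apply h.linking_ext <;> simp [smul_entry]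
  map_zero' := by apply h.linking_ext <;> simp [zero_entry]
  map_add' a b := by apply h.linking_ext <;> simp [add_entry]
  map_mul' a b := by apply h.linking_ext <;> simp [mul_entry]
  map_star' a := by apply h.linking_ext <;> simp [star_entry, map_star]

/-- The embedding of `A₂` as the lower right corner. -/
def inclLower : A₂ →⋆ₙₐ[ℂ] h.linking where
  toFun b := h.entries 0 0 0 b
  map_smul' c a := by apply h.linking_ext <;> simp [smul_entry]
  map_zero' := by apply h.linking_ext <;> simp [zero_entry]
  map_add' a b := by apply h.linking_ext <;> simp [add_entry]
  map_mul' a b := by apply h.linking_ext <;> simp [mul_entry]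
  map_star' a := by apply h.linking_ext <;> simp [star_entry]

theorem inclUpper_apply (a : A₁) : h.inclUpper a = h.entries a 0 0 0 := rfl

theorem inclLower_apply (b : A₂) : h.inclLower b = h.entries 0 0 0 b := rfl

/-- The element `φ (p i) * b` of the off-diagonal corner. -/
def offDiagOf (φ : A₁ →⋆ₙₐ[ℂ] A₂) (p : ι → A₁) (i : ι) (b : A₂) : offDiag φ p :=
  ⟨φ (p i) * b, map_proj_mul_mem φ p i b⟩

theorem mem_of_dense_offDiag {N : Set A₂} (hN : Dense (Submodule.span ℂ N : Set A₂))
    {T : Submodule ℂ (offDiag φ p)} (hT : IsClosed (T : Set (offDiag φ p)))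
    (hmem : ∀ i, ∀ n ∈ N, offDiagOf φ p i n ∈ T) (x : offDiag φ p) : x ∈ T := by
  have hall : ∀ i b, offDiagOf φ p i b ∈ T := fun i b => by
    let g : A₂ →ₗ[ℂ] offDiag φ p :=
      { toFun := offDiagOf φ p i
        map_add' := fun b c => Subtype.ext (mul_add _ _ _)
        map_smul' := fun c b => Subtype.ext (mul_smul_comm _ _ _) }
    have hg : Continuous g := Continuous.subtype_mk (continuous_const_mul _) _
    exact Submodule.mem_of_dense_span (T := T.comap g) hN (hT.preimage hg) (hmem i) b
  have hle : offDiag φ p ≤ (T.map (offDiag φ p).subtype) :=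
    Submodule.topologicalClosure_span_le
      ((isClosed_offDiag φ p).isClosedEmbedding_subtypeVal.isClosedMap _ hT) (by
        rintro _ ⟨i, b, rfl⟩
        exact ⟨_, hall i b, rfl⟩)
  obtain ⟨y, hy, hyx⟩ := hle x.2
  rwa [← Subtype.ext hyx]

/-- The diagonal of the linking algebra: the diagonal matrices with entries in `φ(D₁)` and
`D₂`. -/
def linkingDiagonal : NonUnitalStarSubalgebra ℂ h.linking where
  carrier := {M | M.1 0 0 ∈ D₁.map φ ∧ M.1 0 1 = 0 ∧ M.1 1 0 = 0 ∧ M.1 1 1 ∈ D₂}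
  add_mem' := fun {M N} hM hN => by
    refine ⟨add_mem hM.1 hN.1, ?_, ?_, add_mem hM.2.2.2 hN.2.2.2⟩
    · rw [add_entry, hM.2.1, hN.2.1, add_zero]
    · rw [add_entry, hM.2.2.1, hN.2.2.1, add_zero]
  zero_mem' := ⟨zero_mem _, rfl, rfl, zero_mem _⟩
  smul_mem' := fun c M hM => by
    refine ⟨SMulMemClass.smul_mem c hM.1, ?_, ?_, SMulMemClass.smul_mem c hM.2.2.2⟩
    · rw [smul_entry, hM.2.1, smul_zero]
    · rw [smul_entry, hM.2.2.1, smul_zero]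
  star_mem' := fun {M} hM => by
    refine ⟨star_mem hM.1, ?_, ?_, star_mem hM.2.2.2⟩
    · rw [star_entry, hM.2.2.1, star_zero]
    · rw [star_entry, hM.2.1, star_zero]
  mul_mem' := fun {M N} hM hN => by
    simp only [Set.mem_ofPred_eq, mul_entry, hM.2.1, hM.2.2.1, hN.2.1, hN.2.2.1, zero_mul,
      mul_zero, add_zero, zero_add, true_and]
    exact ⟨mul_mem hM.1 hN.1, mul_mem hM.2.2.2 hN.2.2.2⟩

variable [PartialOrder A₂] [StarOrderedRing A₂]

theorem linking_continuous_entry (i j : Fin 2) : Continuous fun M : h.linking => M.1 i j :=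
  (CStarMatrix.continuous_entry i j).comp continuous_subtype_val

theorem linking_continuous {X : Type*} [TopologicalSpace X] {F : X → h.linking}
    (hF : ∀ i j, Continuous fun x => (F x).1 i j) : Continuous F :=
  Continuous.subtype_mk (CStarMatrix.continuous_of_entries hF) fun x => (F x).2

/-- Replacing the entries outside a set of positions by `0`. -/
def mask (q : Fin 2 → Fin 2 → Prop) [∀ i j, Decidable (q i j)] : h.linking →L[ℂ] h.linking where
  toFun M := ⟨CStarMatrix.ofMatrix fun i j => if q i j then M.1 i j else 0, by
    refine ⟨?_, ?_, ?_⟩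
    · change (if q 0 0 then M.1 0 0 else 0) ∈ NonUnitalStarAlgHom.range φ
      split_ifs
      exacts [M.2.1, zero_mem _]
    · change (if q 0 1 then M.1 0 1 else 0) ∈ offDiag φ p
      split_ifs
      exacts [M.2.2.1, zero_mem _]
    · change star (if q 1 0 then M.1 1 0 else 0) ∈ offDiag φ p
      split_ifs
      exacts [M.2.2.2, by rw [star_zero]; exact zero_mem _]⟩
  map_add' M N := by
    refine Subtype.ext (CStarMatrix.ext fun i j => ?_)
    change (if q i j then M.1 i j + N.1 i j else 0) =
      (if q i j then M.1 i j else 0) + (if q i j then N.1 i j else 0)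
    split_ifs <;> simp
  map_smul' c M := by
    refine Subtype.ext (CStarMatrix.ext fun i j => ?_)
    change (if q i j then c • M.1 i j else 0) = c • (if q i j then M.1 i j else 0)
    split_ifs <;> simp
  cont := h.linking_continuous fun i j => by
    change Continuous fun M : h.linking => if q i j then M.1 i j else 0
    split_ifs
    exacts [h.linking_continuous_entry i j, continuous_const]

/-- Left multiplication by the diagonal matrix unit at `k`: it keeps the row `k`. -/
def row (k : Fin 2) : h.linking →L[ℂ] h.linking := h.mask fun i _ => i = k

/-- Right multiplication by the diagonal matrix unit at `k`: it keeps the column `k`. -/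
def col (k : Fin 2) : h.linking →L[ℂ] h.linking := h.mask fun _ j => j = k

theorem row_entry (k : Fin 2) (M : h.linking) (i j : Fin 2) :
    (h.row k M).1 i j = if i = k then M.1 i j else 0 := rfl

theorem col_entry (k : Fin 2) (M : h.linking) (i j : Fin 2) :
    (h.col k M).1 i j = if j = k then M.1 i j else 0 := rfl

/-- The diagonal matrix unit at `k` as a multiplier of the linking algebra. -/
def diagUnit (k : Fin 2) : DoubleCentralizer ℂ h.linking where
  fst := h.row k
  snd := h.col k
  central M N := by
    refine Subtype.ext (CStarMatrix.ext fun i j => ?_)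
    rw [mul_entry, mul_entry]
    fin_cases k <;> simp [row_entry, col_entry]

theorem isStarProjection_diagUnit (k : Fin 2) : IsStarProjection (h.diagUnit k) := by
  constructor
  · refine DoubleCentralizer.ext _ _ _ _ (Prod.ext ?_ ?_)
    · refine ContinuousLinearMap.ext fun M => Subtype.ext (CStarMatrix.ext fun i j => ?_)
      change (h.row k (h.row k M)).1 i j = (h.row k M).1 i j
      simp only [row_entry]
      split_ifs <;> rfl
    · refine ContinuousLinearMap.ext fun M => Subtype.ext (CStarMatrix.ext fun i j => ?_)
      change (h.col k (h.col k M)).1 i j = (h.col k M).1 i j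
      simp only [col_entry]
      split_ifs <;> rfl
  · refine DoubleCentralizer.ext _ _ _ _ (Prod.ext ?_ ?_)
    · refine ContinuousLinearMap.ext fun M => Subtype.ext (CStarMatrix.ext fun i j => ?_)
      change star ((h.col k (star M)).1 j i) = (h.row k M).1 i j
      rw [row_entry, col_entry, star_entry]
      split_ifs <;> simp
    · refine ContinuousLinearMap.ext fun M => Subtype.ext (CStarMatrix.ext fun i j => ?_)
      change star ((h.row k (star M)).1 j i) = (h.col k M).1 i j
      rw [row_entry, col_entry, star_entry]
      split_ifs <;> simp

theorem diagUnit_add : h.diagUnit 0 + h.diagUnit 1 = 1 := by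
  refine DoubleCentralizer.ext _ _ _ _ (Prod.ext ?_ ?_) <;>
  refine ContinuousLinearMap.ext fun M => Subtype.ext (CStarMatrix.ext fun i j => ?_)
  · change (h.row 0 M).1 i j + (h.row 1 M).1 i j = M.1 i j
    rw [row_entry, row_entry]
    fin_cases i <;> simp
  · change (h.col 0 M).1 i j + (h.col 1 M).1 i j = M.1 i j
    rw [col_entry, col_entry]
    fin_cases j <;> simp

/-- The embedding of the off-diagonal corner in the linking algebra. -/
def inclOffDiag : offDiag φ p →L[ℂ] h.linking where
  toFun x := h.entries 0 x 0 0
  map_smul' c a := by apply h.linking_ext <;> simp [smul_entry]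
  map_add' a b := by apply h.linking_ext <;> simp [add_entry]
  cont := h.linking_continuous fun i j => by
    fin_cases i <;> fin_cases j
    exacts [continuous_const, continuous_subtype_val, continuous_const, continuous_const]

theorem inclOffDiag_apply (x : offDiag φ p) : h.inclOffDiag x = h.entries 0 x 0 0 := rfl

/-- A closed subspace of the linking algebra is everything if it contains enough elements in each
of the four corners. -/
theorem linking_mem_of_dense {N₁ : Set A₁} {N₂ : Set A₂}
    (hN₁ : Dense (Submodule.span ℂ N₁ : Set A₁)) (hN₂ : Dense (Submodule.span ℂ N₂ : Set A₂))
    {T : Submodule ℂ h.linking} (hT : IsClosed (T : Set h.linking))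
    (hup : ∀ n ∈ N₁, h.inclUpper n ∈ T) (hlow : ∀ n ∈ N₂, h.inclLower n ∈ T)
    (hoff : ∀ i, ∀ n ∈ N₂, h.inclOffDiag (offDiagOf φ p i n) ∈ T)
    (hoff' : ∀ i, ∀ n ∈ N₂, star (h.inclOffDiag (offDiagOf φ p i n)) ∈ T) (M : h.linking) :
    M ∈ T := by
  obtain ⟨a, x, y, b, rfl⟩ := exists_entries M
  have ha : h.inclUpper a ∈ T := Submodule.mem_of_dense_span
    (T := T.comap (h.inclUpper : A₁ →ₗ[ℂ] h.linking)) hN₁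
    (hT.preimage h.inclUpper.continuous') hup a
  have hb : h.inclLower b ∈ T := Submodule.mem_of_dense_span
    (T := T.comap (h.inclLower : A₂ →ₗ[ℂ] h.linking)) hN₂
    (hT.preimage h.inclLower.continuous') hlow b
  have hx : h.inclOffDiag x ∈ T := mem_of_dense_offDiag
    (T := T.comap (h.inclOffDiag : offDiag φ p →ₗ[ℂ] h.linking)) hN₂
    (hT.preimage h.inclOffDiag.continuous) hoff x
  -- The adjoint is conjugate-linear, so the lower left corner is reached through `star T`.
  let T' : Submodule ℂ h.linking :=
    { carrier := {M | star M ∈ T}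
      add_mem' := fun {M N} hM hN => by
        change star (M + N) ∈ T
        rw [star_add]; exact add_mem hM hN
      zero_mem' := by
        change star 0 ∈ T
        rw [star_zero]; exact zero_mem _
      smul_mem' := fun c M hM => by
        change star (c • M) ∈ T
        rw [star_smul]; exact T.smul_mem _ hM }
  have hy : star (h.inclOffDiag y) ∈ T := mem_of_dense_offDiag
    (T := T'.comap (h.inclOffDiag : offDiag φ p →ₗ[ℂ] h.linking)) hN₂
    ((hT.preimage continuous_star).preimage h.inclOffDiag.continuous) hoff' y
  have : h.entries a x 0 0 + h.entries 0 0 y b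
      = h.inclUpper a + h.inclOffDiag x + (star (h.inclOffDiag y) + h.inclLower b) := by
    apply h.linking_ext <;>
      simp [inclUpper_apply, inclLower_apply, inclOffDiag_apply, add_entry, star_entry]
  rw [this]
  exact add_mem (add_mem ha hx) (add_mem hy hb)

theorem isFullProjection_diagUnit_zero : IsFullProjection (h.diagUnit 0) := by
  refine ⟨h.isStarProjection_diagUnit 0, ?_⟩
  rw [Submodule.dense_iff_topologicalClosure_eq_top, eq_top_iff]
  rintro M -
  have hpp : ∀ i, φ (p i) * φ (p i) = φ (p i) := fun i => by rw [← map_mul, h.proj_mul_self]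
  refine h.linking_mem_of_dense h.dense_proj h.full (Submodule.isClosed_topologicalClosure _)
    ?_ ?_ ?_ ?_ M
  · rintro _ ⟨i, a, rfl⟩
    refine Submodule.le_topologicalClosure _ (Submodule.subset_span
      ⟨h.inclUpper (p i), h.inclUpper a, ?_⟩)
    apply h.linking_ext <;> simp [inclUpper_apply, mul_entry, diagUnit, row_entry]
  · rintro _ ⟨i, b, c, rfl⟩
    refine Submodule.le_topologicalClosure _ (Submodule.subset_span
      ⟨star (h.inclOffDiag (offDiagOf φ p i (star b))), h.inclOffDiag (offDiagOf φ p i c), ?_⟩)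
    apply h.linking_ext <;> simp [inclLower_apply, inclOffDiag_apply, star_entry, mul_entry,
      diagUnit, row_entry, offDiagOf]
    rw [← map_star, h.star_proj, mul_assoc, mul_assoc b, ← mul_assoc (φ (p i)), hpp]
  · rintro i b -
    refine Submodule.le_topologicalClosure _ (Submodule.subset_span
      ⟨h.inclUpper (p i), h.inclOffDiag (offDiagOf φ p i b), ?_⟩)
    apply h.linking_ext <;> simp [inclUpper_apply, inclOffDiag_apply, mul_entry,
      diagUnit, row_entry, offDiagOf]
    rw [← mul_assoc, hpp]
  · rintro i b -
    refine Submodule.le_topologicalClosure _ (Submodule.subset_span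
      ⟨star (h.inclOffDiag (offDiagOf φ p i b)), h.inclUpper (p i), ?_⟩)
    apply h.linking_ext <;> simp [inclUpper_apply, inclOffDiag_apply, mul_entry,
      diagUnit, row_entry, star_entry, offDiagOf]
    rw [← map_star, h.star_proj, mul_assoc, hpp]

theorem isFullProjection_diagUnit_one : IsFullProjection (h.diagUnit 1) := by
  refine ⟨h.isStarProjection_diagUnit 1, ?_⟩
  rw [Submodule.dense_iff_topologicalClosure_eq_top, eq_top_iff]
  rintro M -
  have hpp : ∀ i, φ (p i) * φ (p i) = φ (p i) := fun i => by rw [← map_mul, h.proj_mul_self]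
  refine h.linking_mem_of_dense h.dense_proj h.full (Submodule.isClosed_topologicalClosure _)
    ?_ ?_ ?_ ?_ M
  · rintro _ ⟨i, a, rfl⟩
    have hst : star (φ (star a)) = φ a := by rw [map_star, star_star]
    refine Submodule.le_topologicalClosure _ (Submodule.subset_span
      ⟨h.inclOffDiag (offDiagOf φ p i (φ (p i))),
        star (h.inclOffDiag ⟨_, h.map_mem_offDiag (star a)⟩), ?_⟩)
    apply h.linking_ext <;> simp [inclUpper_apply, inclOffDiag_apply, mul_entry, diagUnit,
      row_entry, star_entry, offDiagOf, hst, hpp]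
  · rintro _ ⟨i, b, c, rfl⟩
    refine Submodule.le_topologicalClosure _ (Submodule.subset_span
      ⟨h.inclLower (b * φ (p i)), h.inclLower c, ?_⟩)
    apply h.linking_ext <;> simp [inclLower_apply, mul_entry, diagUnit, row_entry]
  · rintro i b -
    refine Submodule.le_topologicalClosure _ (Submodule.subset_span
      ⟨h.inclOffDiag (offDiagOf φ p i (φ (p i))), h.inclLower b, ?_⟩)
    apply h.linking_ext <;> simp [inclLower_apply, inclOffDiag_apply, mul_entry,
      diagUnit, row_entry, offDiagOf, hpp]
  · rintro i b -
    refine Submodule.le_topologicalClosure _ (Submodule.subset_span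
      ⟨h.inclLower (star b),
        star (h.inclOffDiag (offDiagOf φ p i (φ (p i)))), ?_⟩)
    apply h.linking_ext <;> simp [inclLower_apply, inclOffDiag_apply, mul_entry,
      diagUnit, row_entry, star_entry, offDiagOf, hpp]

/-- The entrywise circle action on the linking algebra. -/
def linkingAction : CircleAction h.linking where
  toHom :=
    { toFun := fun z =>
        { toFun := fun M => ⟨CStarMatrix.ofMatrix fun i j => α₂.toHom z (M.1 i j),
            h.action_mem_range z M.2.1, h.action_mem_offDiag z M.2.2.1, by
              change star (α₂.toHom z (M.1 1 0)) ∈ _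
              rw [← map_star]
              exact h.action_mem_offDiag z M.2.2.2⟩
          invFun := fun M => ⟨CStarMatrix.ofMatrix fun i j => α₂.toHom z⁻¹ (M.1 i j),
            h.action_mem_range _ M.2.1, h.action_mem_offDiag _ M.2.2.1, by
              change star (α₂.toHom z⁻¹ (M.1 1 0)) ∈ _
              rw [← map_star]
              exact h.action_mem_offDiag _ M.2.2.2⟩
          left_inv := fun M => Subtype.ext (CStarMatrix.ext fun i j => by
            change (α₂.toHom z⁻¹ * α₂.toHom z) (M.1 i j) = M.1 i j
            rw [← map_mul, inv_mul_cancel, map_one]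
            rfl)
          right_inv := fun M => Subtype.ext (CStarMatrix.ext fun i j => by
            change (α₂.toHom z * α₂.toHom z⁻¹) (M.1 i j) = M.1 i j
            rw [← map_mul, mul_inv_cancel, map_one]
            rfl)
          map_add' := fun M N => Subtype.ext (CStarMatrix.ext fun i j =>
            map_add (α₂.toHom z) (M.1 i j) (N.1 i j))
          map_mul' := fun M N => Subtype.ext (CStarMatrix.ext fun i j => by
            refine (congrArg (α₂.toHom z) (mul_entry M N i j)).trans
              (Eq.trans ?_ (mul_entry _ _ i j).symm)
            rw [map_add, map_mul, map_mul]
            rfl)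
          map_star' := fun M => Subtype.ext (CStarMatrix.ext fun i j =>
            map_star (α₂.toHom z) (M.1 j i))
          map_smul' := fun c M => Subtype.ext (CStarMatrix.ext fun i j =>
            map_smul (α₂.toHom z) c (M.1 i j)) }
      map_one' := StarAlgEquiv.ext fun M => Subtype.ext (CStarMatrix.ext fun i j => by
        change α₂.toHom 1 (M.1 i j) = M.1 i j
        rw [map_one]
        rfl)
      map_mul' := fun z w => StarAlgEquiv.ext fun M =>
        Subtype.ext (CStarMatrix.ext fun i j => by
          change α₂.toHom (z * w) (M.1 i j) = α₂.toHom z (α₂.toHom w (M.1 i j))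
          rw [map_mul]
          rfl) }
  continuous_apply := fun M => h.linking_continuous fun i j => α₂.continuous_apply (M.1 i j)

theorem linkingAction_entry (z : Circle) (M : h.linking) (i j : Fin 2) :
    (h.linkingAction.toHom z M).1 i j = α₂.toHom z (M.1 i j) := rfl

end IsFullDiagonalCorner

/-! ### Morita equivalence by the linking algebra -/

namespace IsFullDiagonalCorner

variable {A₁ A₂ : Type u} {ι : Type w} [NonUnitalCStarAlgebra A₁] [NonUnitalCStarAlgebra A₂]
  {φ : A₁ →⋆ₙₐ[ℂ] A₂} {p : ι → A₁} {α₁ : CircleAction A₁} {D₁ : NonUnitalStarSubalgebra ℂ A₁}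
  {α₂ : CircleAction A₂} {D₂ : NonUnitalStarSubalgebra ℂ A₂}
  (h : IsFullDiagonalCorner α₁ D₁ α₂ D₂ φ p)

section

variable [PartialOrder A₂] [StarOrderedRing A₂]

theorem corner_diagUnit_zero : Set.range h.inclUpper = corner (h.diagUnit 0) := by
  ext M
  constructor
  · rintro ⟨a, rfl⟩
    refine ⟨h.inclUpper a, ?_⟩
    apply h.linking_ext <;> simp [diagUnit, row_entry, col_entry, inclUpper_apply]
  · rintro ⟨N, rfl⟩
    obtain ⟨a, ha⟩ := N.2.1
    refine ⟨a, ?_⟩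
    have ha' : φ a = N.1 0 0 := ha
    apply h.linking_ext <;> simp [diagUnit, row_entry, col_entry, inclUpper_apply, ha']

theorem corner_diagUnit_one : Set.range h.inclLower = corner (h.diagUnit 1) := by
  ext M
  constructor
  · rintro ⟨a, rfl⟩
    refine ⟨h.inclLower a, ?_⟩
    apply h.linking_ext <;> simp [diagUnit, row_entry, col_entry, inclLower_apply]
  · rintro ⟨N, rfl⟩
    refine ⟨N.1 1 1, ?_⟩
    apply h.linking_ext <;> simp [diagUnit, row_entry, col_entry, inclLower_apply]

theorem image_inclUpper :
    h.inclUpper '' (D₁ : Set A₁) = (h.diagUnit 0).fst '' (h.linkingDiagonal : Set h.linking) := by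
  ext M
  constructor
  · rintro ⟨d, hd, rfl⟩
    refine ⟨h.inclUpper d, ⟨⟨d, hd, rfl⟩, rfl, star_zero _, zero_mem _⟩, ?_⟩
    apply h.linking_ext <;> simp [diagUnit, row_entry, inclUpper_apply]
  · rintro ⟨N, ⟨⟨d, hd, hdN⟩, h01, h10, h11⟩, rfl⟩
    refine ⟨d, hd, ?_⟩
    have hdN' : φ d = N.1 0 0 := hdN
    apply h.linking_ext <;> simp [diagUnit, row_entry, inclUpper_apply, hdN', h01]

theorem image_inclLower :
    h.inclLower '' (D₂ : Set A₂) = (h.diagUnit 1).fst '' (h.linkingDiagonal : Set h.linking) := by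
  ext M
  constructor
  · rintro ⟨d, hd, rfl⟩
    refine ⟨h.inclLower d, ⟨⟨0, zero_mem _, rfl⟩, rfl, star_zero _, hd⟩, ?_⟩
    apply h.linking_ext <;> simp [diagUnit, row_entry, inclLower_apply]
  · rintro ⟨N, ⟨-, h01, h10, h11⟩, rfl⟩
    refine ⟨N.1 1 1, h11, ?_⟩
    apply h.linking_ext <;> simp [diagUnit, row_entry, inclLower_apply, h10]

theorem isClosed_linkingDiagonal : IsClosed (h.linkingDiagonal : Set h.linking) :=
  (h.isClosed_map.preimage (h.linking_continuous_entry 0 0)).inter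
    ((isClosed_singleton.preimage (h.linking_continuous_entry 0 1)).inter
      ((isClosed_singleton.preimage (h.linking_continuous_entry 1 0)).inter
        (h.isDiagonal₂.isClosed.preimage (h.linking_continuous_entry 1 1))))

theorem inclUpper_mem_normalizers {n : A₁} (hn : n ∈ normalizers D₁) :
    h.inclUpper n ∈ normalizers h.linkingDiagonal := by
  rintro M ⟨⟨d, hd, hdM⟩, h01, h10, h11⟩
  have hdM' : φ d = M.1 0 0 := hdM
  constructor
  · refine ⟨⟨n * d * star n, (hn d hd).1, ?_⟩, ?_, ?_, ?_⟩
    · change φ _ = _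
      simp [mul_entry, star_entry, inclUpper_apply, ← hdM', map_star]
    · simp [mul_entry, star_entry, inclUpper_apply]
    · simp [mul_entry, star_entry, inclUpper_apply]
    · simp [mul_entry, star_entry, inclUpper_apply]
  · refine ⟨⟨star n * d * n, (hn d hd).2, ?_⟩, ?_, ?_, ?_⟩
    · change φ _ = _
      simp [mul_entry, star_entry, inclUpper_apply, ← hdM', map_star]
    · simp [mul_entry, star_entry, inclUpper_apply]
    · simp [mul_entry, star_entry, inclUpper_apply]
    · simp [mul_entry, star_entry, inclUpper_apply]

theorem inclLower_mem_normalizers {n : A₂} (hn : n ∈ normalizers D₂) :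
    h.inclLower n ∈ normalizers h.linkingDiagonal := by
  rintro M ⟨-, h01, h10, h11⟩
  constructor
  · refine ⟨?_, ?_, ?_, ?_⟩
    · simp [mul_entry, star_entry, inclLower_apply]
    · simp [mul_entry, star_entry, inclLower_apply]
    · simp [mul_entry, star_entry, inclLower_apply]
    · simpa [mul_entry, star_entry, inclLower_apply] using (hn _ h11).1
  · refine ⟨?_, ?_, ?_, ?_⟩
    · simp [mul_entry, star_entry, inclLower_apply]
    · simp [mul_entry, star_entry, inclLower_apply]
    · simp [mul_entry, star_entry, inclLower_apply]
    · simpa [mul_entry, star_entry, inclLower_apply] using (hn _ h11).2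

theorem inclOffDiag_mem_normalizers (i : ι) {n : A₂} (hn : n ∈ normalizers D₂) :
    h.inclOffDiag (offDiagOf φ p i n) ∈ normalizers h.linkingDiagonal := by
  have hs : star (φ (p i)) = φ (p i) := by rw [← map_star, h.star_proj]
  rintro M ⟨⟨d, hd, hdM⟩, h01, h10, h11⟩
  have hdM' : φ d = M.1 0 0 := hdM
  constructor
  · obtain ⟨d', hd', hdd⟩ := h.compress_diagonal i _ (hn _ h11).1
    refine ⟨⟨d', hd', ?_⟩, ?_, ?_, ?_⟩
    · change φ _ = _
      simpa [mul_entry, star_entry, inclOffDiag_apply, offDiagOf, hs, mul_assoc] using hdd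
    · simp [mul_entry, star_entry, inclOffDiag_apply]
    · simp [mul_entry, star_entry, inclOffDiag_apply]
    · simp [mul_entry, star_entry, inclOffDiag_apply]
  · refine ⟨?_, ?_, ?_, ?_⟩
    · simp [mul_entry, star_entry, inclOffDiag_apply]
    · simp [mul_entry, star_entry, inclOffDiag_apply]
    · simp [mul_entry, star_entry, inclOffDiag_apply]
    · have := (hn _ (h.map_diagonal _ (mul_mem (mul_mem (h.proj_mem i) hd) (h.proj_mem i)))).2
      simpa [mul_entry, star_entry, inclOffDiag_apply, offDiagOf, hs, mul_assoc, ← hdM']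
        using this

theorem isDiagonal_linkingDiagonal : IsDiagonal h.linkingDiagonal where
  isClosed := h.isClosed_linkingDiagonal
  comm := by
    rintro M ⟨⟨d, hd, hdM⟩, h01, h10, h11⟩ N ⟨⟨d', hd', hdN⟩, k01, k10, k11⟩
    have hdM' : φ d = M.1 0 0 := hdM
    have hdN' : φ d' = N.1 0 0 := hdN
    apply h.linking_ext <;> simp only [mul_entry, h01, h10, k01, k10, mul_zero, zero_mul,
      add_zero, zero_add]
    · rw [← hdM', ← hdN', ← map_mul, ← map_mul, h.isDiagonal₁.comm d hd d' hd']
    · exact h.isDiagonal₂.comm _ h11 _ k11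
  regular := by
    rw [Submodule.dense_iff_topologicalClosure_eq_top, eq_top_iff]
    rintro M -
    have hle : ∀ n ∈ normalizers h.linkingDiagonal,
        n ∈ (Submodule.span ℂ (normalizers h.linkingDiagonal)).topologicalClosure := fun n hn =>
      Submodule.le_topologicalClosure _ (Submodule.subset_span hn)
    exact h.linking_mem_of_dense h.isDiagonal₁.regular h.isDiagonal₂.regular
      (Submodule.isClosed_topologicalClosure _)
      (fun n hn => hle _ (h.inclUpper_mem_normalizers hn))
      (fun n hn => hle _ (h.inclLower_mem_normalizers hn))
      (fun i n hn => hle _ (h.inclOffDiag_mem_normalizers i hn))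
      (fun i n hn => hle _ (star_mem_normalizers (h.inclOffDiag_mem_normalizers i hn))) M

end

include h in
/-- The linking algebra of a full corner that respects actions and diagonals witnesses a Morita
equivalence of triples. -/
theorem moritaEquivalent : MoritaEquivalent α₁ D₁ α₂ D₂ := by
  let _ : PartialOrder A₂ := CStarAlgebra.spectralOrder A₂
  have _ : StarOrderedRing A₂ := CStarAlgebra.spectralOrderedRing A₂
  refine ⟨h.linking, inferInstance, h.diagUnit 0, h.diagUnit 1, h.inclUpper, h.inclLower,
    h.linkingAction, h.linkingDiagonal, ?_⟩
  refine
    { full₁ := h.isFullProjection_diagUnit_zero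
      full₂ := h.isFullProjection_diagUnit_one
      complementary := h.diagUnit_add
      injective₁ := fun a b hab => ?_
      injective₂ := fun a b hab => congrArg (fun M : h.linking => M.1 1 1) hab
      range₁ := h.corner_diagUnit_zero
      range₂ := h.corner_diagUnit_one
      equivariant₁ := fun z a => ?_
      equivariant₂ := fun z a => ?_
      isDiagonal := h.isDiagonal_linkingDiagonal
      diagonal₁ := h.image_inclUpper
      diagonal₂ := h.image_inclLower }
  · exact h.injective (congrArg (fun M : h.linking => M.1 0 0) hab)
  · apply h.linking_ext <;> simp [linkingAction_entry, inclUpper_apply, h.equivariant]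
  · apply h.linking_ext <;> simp [linkingAction_entry, inclLower_apply]

end IsFullDiagonalCorner

/-! ### The diagonal of a graph algebra -/

namespace GraphCStar

variable {E : DirectedGraph.{u}}

theorem star_proj (v : E.Vertex) : star (proj v : GraphCStar E) = proj v := isCKFamily.star_proj v

theorem proj_mul_proj (v : E.Vertex) : (proj v * proj v : GraphCStar E) = proj v :=
  isCKFamily.proj_mul_self v

theorem proj_mul_proj_of_ne {v w : E.Vertex} (h : v ≠ w) : (proj v * proj w : GraphCStar E) = 0 :=
  isCKFamily.proj_orthogonal v w h

theorem star_isom_mul_isom (e : E.Edge) :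
    star (isom e : GraphCStar E) * isom e = proj (E.s e) := isCKFamily.ck1 e

theorem star_isom_mul_isom_of_ne {e e' : E.Edge} (h : e ≠ e') :
    star (isom e : GraphCStar E) * isom e' = 0 := isCKFamily.range_orthogonal e e' h

theorem proj_mul_isom (e : E.Edge) : (proj (E.r e) * isom e : GraphCStar E) = isom e :=
  isCKFamily.range_le e

theorem proj_mul_isom_of_ne {v : E.Vertex} {e : E.Edge} (h : v ≠ E.r e) :
    (proj v * isom e : GraphCStar E) = 0 := by
  rw [← proj_mul_isom, ← mul_assoc, proj_mul_proj_of_ne h, zero_mul]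

/-- An element of a C*-algebra whose absolute value is a projection `q` satisfies `a q = a`. -/
theorem mul_eq_self_of_star_mul_self {A : Type*} [NonUnitalCStarAlgebra A] {a q : A}
    (h : star a * a = q) (hs : star q = q) (hq : q * q = q) : a * q = a := by
  rw [← sub_eq_zero, ← CStarRing.star_mul_self_eq_zero_iff]
  simp only [star_sub, star_mul, hs, sub_mul, mul_sub, ← mul_assoc, h, hq]
  simp only [mul_assoc, h, hq]
  simp

theorem isom_mul_proj (e : E.Edge) : (isom e * proj (E.s e) : GraphCStar E) = isom e :=
  mul_eq_self_of_star_mul_self (star_isom_mul_isom e) (star_proj _) (proj_mul_proj _)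

theorem proj_mul_path {v w : E.Vertex} (μ : FinitePath E v w) :
    proj v * path μ = path μ := by
  cases μ with
  | vertex v => exact proj_mul_proj v
  | cons e μ => rw [path, ← mul_assoc, proj_mul_isom]

theorem proj_mul_path_of_ne {u v w : E.Vertex} (h : u ≠ v) (μ : FinitePath E v w) :
    proj u * path μ = 0 := by
  rw [← proj_mul_path, ← mul_assoc, proj_mul_proj_of_ne h, zero_mul]

theorem path_mul_proj {v w : E.Vertex} (μ : FinitePath E v w) :
    path μ * proj w = path μ := by
  induction μ with
  | vertex v => exact proj_mul_proj v
  | cons e μ ih => rw [path, mul_assoc, ih]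

/-- The range projection `s_μ s_μ*`. -/
def rangeProj {v w : E.Vertex} (μ : FinitePath E v w) : GraphCStar E := path μ * star (path μ)

theorem star_rangeProj {v w : E.Vertex} (μ : FinitePath E v w) :
    star (rangeProj μ) = rangeProj μ := by
  rw [rangeProj, star_mul, star_star]

theorem rangeProj_vertex (v : E.Vertex) :
    rangeProj (FinitePath.vertex v : FinitePath E v v) = proj v := by
  rw [rangeProj, path, star_proj, proj_mul_proj]

theorem rangeProj_cons (e : E.Edge) {w : E.Vertex} (μ : FinitePath E (E.s e) w) :
    rangeProj (FinitePath.cons e μ) = isom e * rangeProj μ * star (isom e) := by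
  simp only [rangeProj, path, star_mul, mul_assoc]

theorem proj_mul_rangeProj {v w : E.Vertex} (μ : FinitePath E v w) :
    proj v * rangeProj μ = rangeProj μ := by
  rw [rangeProj, ← mul_assoc, proj_mul_path]

theorem rangeProj_mul_proj {v w : E.Vertex} (μ : FinitePath E v w) :
    rangeProj μ * proj v = rangeProj μ := by
  simpa [star_mul, star_rangeProj, star_proj] using congrArg star (proj_mul_rangeProj μ)

theorem proj_mul_rangeProj_of_ne {u v w : E.Vertex} (h : u ≠ v) (μ : FinitePath E v w) :
    proj u * rangeProj μ = 0 := by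
  rw [rangeProj, ← mul_assoc, proj_mul_path_of_ne h, zero_mul]

theorem rangeProj_mul_proj_of_ne {u v w : E.Vertex} (h : u ≠ v) (μ : FinitePath E v w) :
    rangeProj μ * proj u = 0 := by
  simpa [star_mul, star_rangeProj, star_proj] using congrArg star (proj_mul_rangeProj_of_ne h μ)

theorem commute_proj_rangeProj (u : E.Vertex) {v w : E.Vertex} (μ : FinitePath E v w) :
    Commute (proj u) (rangeProj μ) := by
  rcases eq_or_ne u v with rfl | h
  · exact (proj_mul_rangeProj μ).trans (rangeProj_mul_proj μ).symm
  · exact (proj_mul_rangeProj_of_ne h μ).trans (rangeProj_mul_proj_of_ne h μ).symm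

/-- The range projections of two paths commute: strip off common first edges until the paths branch
or one of them is a vertex. -/
theorem commute_rangeProj {v w v' w' : E.Vertex} (μ : FinitePath E v w)
    (ν : FinitePath E v' w') : Commute (rangeProj μ) (rangeProj ν) := by
  induction μ generalizing v' w' with
  | vertex v => rw [rangeProj_vertex]; exact commute_proj_rangeProj v ν
  | cons e μ ih =>
    cases ν with
    | vertex v => rw [rangeProj_vertex]; exact (commute_proj_rangeProj _ _).symm
    | cons e' ν =>
      rw [rangeProj_cons, rangeProj_cons]
      rcases eq_or_ne e e' with rfl | h
      · have key : ∀ x y : GraphCStar E, x * proj (E.s e) = x →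
            isom e * x * star (isom e) * (isom e * y * star (isom e))
              = isom e * (x * y) * star (isom e) := fun x y hx => by
          calc _ = isom e * (x * (star (isom e) * isom e)) * y * star (isom e) := by
                simp only [mul_assoc]
            _ = _ := by rw [star_isom_mul_isom, hx]; simp only [mul_assoc]
        change _ = _
        rw [key _ _ (rangeProj_mul_proj μ), key _ _ (rangeProj_mul_proj ν), (ih ν).eq]
      · have key : ∀ (f f' : E.Edge) (x y : GraphCStar E), f ≠ f' →
            isom f * x * star (isom f) * (isom f' * y * star (isom f')) = 0 :=
          fun f f' x y hf => by
          calc _ = isom f * x * (star (isom f) * isom f') * y * star (isom f') := by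
                simp only [mul_assoc]
            _ = 0 := by rw [star_isom_mul_isom_of_ne hf]; simp
        exact (key _ _ _ _ h).trans (key _ _ _ _ h.symm).symm

theorem rangeProj_mem_diagonal {v w : E.Vertex} (μ : FinitePath E v w) :
    rangeProj μ ∈ diagonal E :=
  NonUnitalStarSubalgebra.le_topologicalClosure _
    (NonUnitalStarAlgebra.subset_adjoin ℂ _ ⟨v, w, μ, rfl⟩)

theorem proj_mem_diagonal (v : E.Vertex) : proj v ∈ diagonal E := by
  rw [← rangeProj_vertex]
  exact rangeProj_mem_diagonal _

theorem isClosed_diagonal : IsClosed (diagonal E : Set (GraphCStar E)) :=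
  NonUnitalStarSubalgebra.isClosed_topologicalClosure _

/-- Induction over the diagonal. -/
theorem diagonal_induction {motive : GraphCStar E → Prop} (closed : IsClosed {x | motive x})
    (rangeProj : ∀ {v w : E.Vertex} (μ : FinitePath E v w), motive (rangeProj μ))
    (zero : motive 0) (add : ∀ x y, motive x → motive y → motive (x + y))
    (smul : ∀ (c : ℂ) x, motive x → motive (c • x)) (star : ∀ x, motive x → motive (star x))
    (mul : ∀ x ∈ diagonal E, ∀ y ∈ diagonal E, motive x → motive y → motive (x * y))
    {x : GraphCStar E} (hx : x ∈ diagonal E) : motive x := by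
  let S : NonUnitalStarSubalgebra ℂ (GraphCStar E) :=
    { carrier := {x | x ∈ diagonal E ∧ motive x}
      add_mem' := fun hx hy => ⟨add_mem hx.1 hy.1, add _ _ hx.2 hy.2⟩
      zero_mem' := ⟨zero_mem _, zero⟩
      mul_mem' := fun hx hy => ⟨mul_mem hx.1 hy.1, mul _ hx.1 _ hy.1 hx.2 hy.2⟩
      smul_mem' := fun c _ hx => ⟨SMulMemClass.smul_mem c hx.1, smul c _ hx.2⟩
      star_mem' := fun hx => ⟨star_mem hx.1, star _ hx.2⟩ }
  have hS : diagonal E ≤ S := by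
    refine NonUnitalStarSubalgebra.topologicalClosure_minimal _ ?_ (isClosed_diagonal.inter closed)
    refine NonUnitalStarAlgebra.adjoin_le ?_
    rintro _ ⟨v, w, μ, rfl⟩
    exact ⟨rangeProj_mem_diagonal μ, rangeProj μ⟩
  exact (hS hx).2

theorem diagonal_comm {x y : GraphCStar E} (hx : x ∈ diagonal E) (hy : y ∈ diagonal E) :
    x * y = y * x := by
  have h1 : ∀ {v w : E.Vertex} (μ : FinitePath E v w), ∀ x ∈ diagonal E,
      x * rangeProj μ = rangeProj μ * x := fun μ x hx =>
    diagonal_induction (motive := fun x => x * rangeProj μ = rangeProj μ * x)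
      (isClosed_eq (by fun_prop) (by fun_prop)) (fun ν => (commute_rangeProj ν μ).eq) (by simp)
      (fun x y hx hy => by rw [add_mul, mul_add, hx, hy])
      (fun c x hx => by rw [smul_mul_assoc, mul_smul_comm, hx])
      (fun x hx => by simpa [star_mul, star_rangeProj] using (congrArg star hx).symm)
      (fun x _ y _ hx hy => by rw [mul_assoc, hy, ← mul_assoc, hx, mul_assoc]) hx
  refine diagonal_induction (motive := fun y => ∀ x ∈ diagonal E, x * y = y * x) ?_
    (fun μ => h1 μ) (by simp) (fun y z hy hz x hx => by rw [add_mul, mul_add, hy x hx, hz x hx])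
    (fun c y hy x hx => by rw [smul_mul_assoc, mul_smul_comm, hy x hx])
    (fun y hy x hx => by
      simpa [star_mul] using (congrArg star (hy (star x) (star_mem hx))).symm)
    (fun y _ z _ hy hz x hx => by rw [← mul_assoc, hy x hx, mul_assoc, hz x hx, mul_assoc]) hy x hx
  rw [show {y : GraphCStar E | ∀ x ∈ diagonal E, x * y = y * x}
    = ⋂ x ∈ diagonal E, {y | x * y = y * x} by ext; simp]
  exact isClosed_biInter fun x _ => isClosed_eq (by fun_prop) (by fun_prop)

/-- The initial projection `s_e* s_e = p_{s(e)}` commutes with the diagonal, so `d ↦ s_e d s_e*` is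
multiplicative on it and only range projections have to be checked. -/
theorem isom_mul_mem_diagonal (e : E.Edge) {d : GraphCStar E} (hd : d ∈ diagonal E) :
    isom e * d * star (isom e) ∈ diagonal E := by
  refine diagonal_induction (motive := fun d => isom e * d * star (isom e) ∈ diagonal E)
    (isClosed_diagonal.preimage (by fun_prop)) (fun {v w} μ => ?_) (by simp)
    (fun x y hx hy => by rw [mul_add, add_mul]; exact add_mem hx hy)
    (fun c x hx => by
      rw [mul_smul_comm, smul_mul_assoc]
      exact SMulMemClass.smul_mem c hx)
    (fun x hx => by simpa [star_mul, mul_assoc] using star_mem hx)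
    (fun x hx y hy hxe hye => ?_) hd
  · by_cases h : E.s e = v
    · subst h
      rw [← rangeProj_cons]
      exact rangeProj_mem_diagonal _
    · rw [← isom_mul_proj, mul_assoc (isom e), proj_mul_rangeProj_of_ne h]
      simp
  · have := mul_mem hxe hye
    have hxy : isom e * x * star (isom e) * (isom e * y * star (isom e))
        = isom e * (x * y) * star (isom e) := by
      calc _ = isom e * (x * (star (isom e) * isom e)) * y * star (isom e) := by
            simp only [mul_assoc]
        _ = isom e * proj (E.s e) * x * y * star (isom e) := by
            rw [star_isom_mul_isom, diagonal_comm hx (proj_mem_diagonal _)]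
            simp only [mul_assoc]
        _ = _ := by rw [isom_mul_proj]; simp only [mul_assoc]
    rwa [hxy] at this

theorem star_isom_mul_mem_diagonal (e : E.Edge) {d : GraphCStar E} (hd : d ∈ diagonal E) :
    star (isom e) * d * isom e ∈ diagonal E := by
  have hee : isom e * star (isom e) ∈ diagonal E := by
    have := isom_mul_mem_diagonal e (proj_mem_diagonal (E.s e))
    rwa [isom_mul_proj] at this
  refine diagonal_induction (motive := fun d => star (isom e) * d * isom e ∈ diagonal E)
    (isClosed_diagonal.preimage (by fun_prop)) (fun {v w} μ => ?_) (by simp)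
    (fun x y hx hy => by rw [mul_add, add_mul]; exact add_mem hx hy)
    (fun c x hx => by
      rw [mul_smul_comm, smul_mul_assoc]
      exact SMulMemClass.smul_mem c hx)
    (fun x hx => by simpa [star_mul, mul_assoc] using star_mem hx)
    (fun x hx y hy hxe hye => ?_) hd
  · cases μ with
    | vertex v =>
      rw [rangeProj_vertex]
      by_cases h : v = E.r e
      · rw [h, mul_assoc, proj_mul_isom, star_isom_mul_isom]
        exact proj_mem_diagonal _
      · rw [mul_assoc, proj_mul_isom_of_ne h, mul_zero]
        exact zero_mem _
    | cons e' μ =>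
      rw [rangeProj_cons]
      have h1 : star (isom e) * (isom e' * rangeProj μ * star (isom e')) * isom e
          = star (isom e) * isom e' * rangeProj μ * (star (isom e') * isom e) := by
        simp only [mul_assoc]
      rw [h1]
      by_cases h : e = e'
      · subst h
        rw [star_isom_mul_isom, proj_mul_rangeProj, rangeProj_mul_proj]
        exact rangeProj_mem_diagonal μ
      · rw [star_isom_mul_isom_of_ne h, zero_mul, zero_mul]
        exact zero_mem _
  · have := mul_mem hxe hye
    have hxy : star (isom e) * x * isom e * (star (isom e) * y * isom e)
        = star (isom e) * (x * y) * isom e := by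
      calc _ = star (isom e) * (x * (isom e * star (isom e))) * y * isom e := by
            simp only [mul_assoc]
        _ = star (isom e) * isom e * star (isom e) * x * y * isom e := by
            rw [diagonal_comm hx hee]
            simp only [mul_assoc]
        _ = star (isom e * (star (isom e) * isom e)) * x * y * isom e := by
            simp only [star_mul, star_star]
        _ = _ := by rw [star_isom_mul_isom, isom_mul_proj]; simp only [mul_assoc]
    rwa [hxy] at this

/-- An induction principle for membership in closed subspaces of `C*(E)`: the words in the
generators span a dense subspace. -/
theorem mem_of_word_mem {T : Submodule ℂ (GraphCStar E)} (hT : IsClosed (T : Set (GraphCStar E)))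
    (h : ∀ m : FreeSemigroup (CKLetter E), of (CKFree.word m 1) ∈ T) (x : GraphCStar E) :
    x ∈ T := by
  induction x using induction₁ with
  | hp => exact hT
  | h x =>
    induction x using CKFree.induction_word with
    | zero => simp
    | add x y hx hy => rw [of_add]; exact add_mem hx hy
    | word m c =>
      have := T.smul_mem c (h m)
      rwa [← of_smul, CKFree.smul_word, mul_one] at this

theorem of_word_mul (a : CKLetter E) (m : FreeSemigroup (CKLetter E)) :
    of (CKFree.word (FreeSemigroup.of a * m) 1)
      = of (CKFree.word (FreeSemigroup.of a) 1) * of (CKFree.word m 1) := by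
  rw [← of_mul, CKFree.word_mul_word, one_mul]

theorem of_word_proj (v : E.Vertex) :
    of (CKFree.word (FreeSemigroup.of (CKLetter.proj v)) 1) = proj v := rfl

theorem of_word_iso (e : E.Edge) :
    of (CKFree.word (FreeSemigroup.of (CKLetter.iso e)) 1) = isom e := rfl

theorem of_word_isoStar (e : E.Edge) :
    of (CKFree.word (FreeSemigroup.of (CKLetter.isoStar e)) 1) = star (isom e) := by
  rw [← CKFree.star_iso, of_star]
  rfl

theorem isom_mem_normalizers (e : E.Edge) : isom e ∈ normalizers (diagonal E) :=
  fun _ hd => ⟨isom_mul_mem_diagonal e hd, star_isom_mul_mem_diagonal e hd⟩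

theorem proj_mem_normalizers (v : E.Vertex) : proj v ∈ normalizers (diagonal E) := fun d hd => by
  rw [star_proj]
  have := mul_mem (mul_mem (proj_mem_diagonal v) hd) (proj_mem_diagonal v)
  exact ⟨this, this⟩

theorem word_mem_normalizers (m : FreeSemigroup (CKLetter E)) :
    of (CKFree.word m 1) ∈ normalizers (diagonal E) := by
  have hof : ∀ a : CKLetter E,
      of (CKFree.word (FreeSemigroup.of a) 1) ∈ normalizers (diagonal E) := by
    rintro (v | e | e)
    · exact proj_mem_normalizers v
    · exact isom_mem_normalizers e
    · rw [of_word_isoStar]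
      exact star_mem_normalizers (isom_mem_normalizers e)
  induction m using FreeSemigroup.recOnMul with
  | ih1 a => exact hof a
  | ih2 a m _ ih => rw [of_word_mul]; exact mul_mem_normalizers (hof a) ih

/-- The generators normalise the diagonal, hence so do the words in them, which span a dense
subspace. -/
theorem isDiagonal_diagonal (E : DirectedGraph.{u}) : IsDiagonal (diagonal E) where
  isClosed := isClosed_diagonal
  comm _ hx _ hy := diagonal_comm hx hy
  regular := by
    rw [Submodule.dense_iff_topologicalClosure_eq_top, eq_top_iff]
    rintro x -
    exact mem_of_word_mem (Submodule.isClosed_topologicalClosure _) (fun m =>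
      Submodule.le_topologicalClosure _ (Submodule.subset_span (word_mem_normalizers m))) x

/-- Every word in the generators is fixed by the vertex projection on its left. -/
theorem exists_proj_mul_word (m : FreeSemigroup (CKLetter E)) :
    ∃ v, proj v * of (CKFree.word m 1) = of (CKFree.word m 1) := by
  have hof : ∀ a : CKLetter E, ∃ v, proj v * of (CKFree.word (FreeSemigroup.of a) 1)
      = of (CKFree.word (FreeSemigroup.of a) 1) := by
    rintro (v | e | e)
    · exact ⟨v, proj_mul_proj v⟩
    · exact ⟨E.r e, proj_mul_isom e⟩
    · refine ⟨E.s e, ?_⟩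
      rw [of_word_isoStar, ← star_proj, ← star_mul, isom_mul_proj]
  induction m using FreeSemigroup.recOnMul with
  | ih1 a => exact hof a
  | ih2 a m _ _ =>
    obtain ⟨v, hv⟩ := hof a
    exact ⟨v, by rw [of_word_mul, ← mul_assoc, hv]⟩

theorem dense_span_proj_mul :
    Dense (Submodule.span ℂ {x : GraphCStar E | ∃ v a, x = proj v * a} : Set (GraphCStar E)) := by
  rw [Submodule.dense_iff_topologicalClosure_eq_top, eq_top_iff]
  rintro x -
  refine mem_of_word_mem (Submodule.isClosed_topologicalClosure _) (fun m => ?_) x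
  obtain ⟨v, hv⟩ := exists_proj_mul_word m
  exact Submodule.le_topologicalClosure _ (Submodule.subset_span ⟨v, _, hv.symm⟩)

end GraphCStar

/-! ### The covering of a graph by its out-split -/

namespace OutSplitting

variable {E : DirectedGraph.{u}} (P : OutSplitting E)

/-- The vertex of `E` of which a vertex of the out-split graph is a copy. -/
def under : P.graph.Vertex → E.Vertex
  | Vertex.copy v _ _ => v
  | Vertex.whole v _ => v

/-- The number of the copy; unsplit vertices count as copy `0`. -/
def idx : P.graph.Vertex → ℕ
  | Vertex.copy _ i _ => i
  | Vertex.whole _ _ => 0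

/-- The edge of `E` of which an edge of the out-split graph is a copy. -/
def underEdge : P.graph.Edge → E.Edge
  | Edge.copy e _ _ => e
  | Edge.whole e _ => e

/-- The copy of `v` with number `0`. -/
def baseVertex (v : E.Vertex) : P.graph.Vertex :=
  open Classical in
  if h : P.m v = 0 then Vertex.whole v h else Vertex.copy v 0 (pos_iff_ne_zero.2 h)

/-- The copy of `e` with number `0`. -/
def baseEdge (e : E.Edge) : P.graph.Edge :=
  open Classical in
  if h : P.m (E.r e) = 0 then Edge.whole e h else Edge.copy e 0 (pos_iff_ne_zero.2 h)

variable {P}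

theorem baseVertex_of_eq {v : E.Vertex} (h : P.m v = 0) :
    P.baseVertex v = Vertex.whole v h := dif_pos h

theorem baseVertex_of_ne {v : E.Vertex} (h : P.m v ≠ 0) :
    P.baseVertex v = Vertex.copy v 0 (pos_iff_ne_zero.2 h) := dif_neg h

theorem baseEdge_of_eq {e : E.Edge} (h : P.m (E.r e) = 0) :
    P.baseEdge e = Edge.whole e h := dif_pos h

theorem baseEdge_of_ne {e : E.Edge} (h : P.m (E.r e) ≠ 0) :
    P.baseEdge e = Edge.copy e 0 (pos_iff_ne_zero.2 h) := dif_neg h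

@[simp] theorem under_baseVertex (v : E.Vertex) : P.under (P.baseVertex v) = v := by
  by_cases h : P.m v = 0
  · rw [baseVertex_of_eq h]; rfl
  · rw [baseVertex_of_ne h]; rfl

@[simp] theorem idx_baseVertex (v : E.Vertex) : P.idx (P.baseVertex v) = 0 := by
  by_cases h : P.m v = 0
  · rw [baseVertex_of_eq h]; rfl
  · rw [baseVertex_of_ne h]; rfl

@[simp] theorem underEdge_baseEdge (e : E.Edge) : P.underEdge (P.baseEdge e) = e := by
  by_cases h : P.m (E.r e) = 0
  · rw [baseEdge_of_eq h]; rfl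
  · rw [baseEdge_of_ne h]; rfl

theorem vertex_ext {x y : P.graph.Vertex} (h : P.under x = P.under y) (hi : P.idx x = P.idx y) :
    x = y := by
  rcases x with ⟨v, i, hv⟩ | ⟨v, hv⟩ <;> rcases y with ⟨w, j, hw⟩ | ⟨w, hw⟩ <;>
    obtain rfl : v = w := h
  · obtain rfl : i = j := hi
    rfl
  · simp [hw] at hv
  · simp [hv] at hw
  · rfl

@[simp] theorem range_baseEdge (e : E.Edge) :
    P.graph.r (P.baseEdge e) = P.baseVertex (E.r e) := by
  by_cases h : P.m (E.r e) = 0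
  · rw [baseEdge_of_eq h, baseVertex_of_eq h]; rfl
  · rw [baseEdge_of_ne h, baseVertex_of_ne h]; rfl

theorem under_range (e : P.graph.Edge) : P.under (P.graph.r e) = E.r (P.underEdge e) := by
  rcases e with ⟨e, i, h⟩ | ⟨e, h⟩ <;> rfl

theorem source_eq (e : P.graph.Edge) : P.graph.s e = P.sourceVertex (P.underEdge e) := by
  rcases e with ⟨e, i, h⟩ | ⟨e, h⟩ <;> rfl

theorem under_source (e : P.graph.Edge) : P.under (P.graph.s e) = E.s (P.underEdge e) := by
  rw [source_eq]; unfold sourceVertex; split_ifs <;> rfl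

theorem source_baseEdge (e : P.graph.Edge) :
    P.graph.s (P.baseEdge (P.underEdge e)) = P.graph.s e := by
  rw [source_eq, source_eq, underEdge_baseEdge]

/-- Uniqueness of lifts of edges with prescribed range. -/
theorem edge_ext {e e' : P.graph.Edge} (h : P.underEdge e = P.underEdge e')
    (hr : P.graph.r e = P.graph.r e') : e = e' := by
  rcases e with ⟨v, i, hv⟩ | ⟨v, hv⟩ <;> rcases e' with ⟨w, j, hw⟩ | ⟨w, hw⟩ <;>
    obtain rfl : v = w := h
  · obtain rfl : i = j := congrArg P.idx hr
    rfl
  · simp [hw] at hv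
  · simp [hv] at hw
  · rfl

/-- Unique lifting of edges: every edge lifts to an edge with prescribed range. -/
theorem exists_edge (x : P.graph.Vertex) (e : E.Edge) (h : E.r e = P.under x) :
    ∃ e' : P.graph.Edge, P.underEdge e' = e ∧ P.graph.r e' = x := by
  rcases x with ⟨v, i, hv⟩ | ⟨v, hv⟩ <;> obtain rfl : E.r e = v := h
  · exact ⟨Edge.copy e i hv, rfl, rfl⟩
  · exact ⟨Edge.whole e hv, rfl, rfl⟩

theorem baseEdge_underEdge {e : P.graph.Edge} {v : E.Vertex} (h : P.graph.r e = P.baseVertex v) :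
    P.baseEdge (P.underEdge e) = e := by
  refine edge_ext (by simp) ?_
  have := congrArg P.under h
  rw [under_range, under_baseVertex] at this
  rw [range_baseEdge, this, h]

theorem baseEdge_injective : Function.Injective P.baseEdge :=
  Function.LeftInverse.injective underEdge_baseEdge

theorem isSource_iff (x : P.graph.Vertex) : P.graph.IsSource x ↔ E.IsSource (P.under x) := by
  simp only [DirectedGraph.IsSource, Set.eq_empty_iff_forall_notMem, Set.mem_preimage,
    Set.mem_singleton_iff]
  constructor
  · intro h e he
    obtain ⟨e', -, he'⟩ := exists_edge x e he
    exact h e' he'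
  · rintro h e rfl
    exact h (P.underEdge e) (under_range e).symm

/-- Sources are not split. -/
theorem baseVertex_of_isSource {x : P.graph.Vertex} (h : E.IsSource (P.under x)) :
    P.baseVertex (P.under x) = x := by
  rcases x with ⟨v, i, hv⟩ | ⟨v, hv⟩
  · have : P.m v = 0 := P.m_of_isSource v h
    simp [this] at hv
  · exact baseVertex_of_eq hv

theorem rowFinite_graph (hE : E.RowFinite) : P.graph.RowFinite := fun x => by
  refine Set.Finite.of_finite_image (f := P.underEdge) ((hE (P.under x)).subset ?_) ?_
  · rintro _ ⟨e, rfl, rfl⟩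
    exact (under_range e).symm
  · rintro e he e' he' h
    exact edge_ext h (he.trans he'.symm)

/-- By unique lifting, a sum over the edges with range `x` is a sum over the edges with range
below `x`. -/
theorem sum_underEdge (hE : E.RowFinite) (x : P.graph.Vertex) {M : Type*} [AddCommMonoid M]
    (F : E.Edge → M) :
    ∑ e ∈ (rowFinite_graph hE x).toFinset, F (P.underEdge e)
      = ∑ e ∈ (hE (P.under x)).toFinset, F e := by
  refine Finset.sum_bij (fun e _ => P.underEdge e) (fun e he => ?_) (fun e he e' he' h => ?_)
    (fun e he => ?_) (fun _ _ => rfl)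
  · simp only [Set.Finite.mem_toFinset, Set.mem_preimage, Set.mem_singleton_iff] at he ⊢
    rw [← under_range, he]
  · simp only [Set.Finite.mem_toFinset, Set.mem_preimage, Set.mem_singleton_iff] at he he'
    exact edge_ext h (he.trans he'.symm)
  · simp only [Set.Finite.mem_toFinset, Set.mem_preimage, Set.mem_singleton_iff] at he
    obtain ⟨e', h1, h2⟩ := exists_edge x e he
    exact ⟨e', by simpa using h2, h1⟩

/-! ### Moving between the copies of a vertex -/

/-- The element `∑ s_{e⁰} s_{eˣ}*` of the free *-algebra, the sum over the edges `e` with range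
below `x`, where `eˣ` is the copy of `e` with range `x`. At a source it is the vertex itself. Its
image in `C*` is a partial isometry from the projection of `x` onto that of copy `0`. -/
def transferFree (hE : E.RowFinite) (x : P.graph.Vertex) : CKFree P.graph :=
  open Classical in
  if E.IsSource (P.under x) then CKFree.proj x
  else ∑ e ∈ (rowFinite_graph hE x).toFinset,
    CKFree.iso (P.baseEdge (P.underEdge e)) * star (CKFree.iso e)

/-- The image of `transferFree` in the graph algebra. -/
def transfer (hE : E.RowFinite) (x : P.graph.Vertex) : GraphCStar P.graph :=
  GraphCStar.of (transferFree hE x)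

variable (hE : E.RowFinite)

open GraphCStar

theorem transfer_of_isSource {x : P.graph.Vertex} (h : E.IsSource (P.under x)) :
    transfer hE x = proj x := by
  rw [transfer, transferFree, if_pos h]
  rfl

theorem transfer_of_not_isSource {x : P.graph.Vertex} (h : ¬ E.IsSource (P.under x)) :
    transfer hE x = ∑ e ∈ (rowFinite_graph hE x).toFinset,
      isom (P.baseEdge (P.underEdge e)) * star (isom e) := by
  rw [transfer, transferFree, if_neg h, map_sum]
  simp only [of_mul, of_star]
  rfl

theorem not_isSource_range (e : P.graph.Edge) : ¬ E.IsSource (P.under (P.graph.r e)) := by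
  rw [← isSource_iff]
  intro h
  have : e ∈ P.graph.r ⁻¹' {P.graph.r e} := rfl
  rw [h] at this
  exact this

theorem transfer_mul_isom (e : P.graph.Edge) :
    transfer hE (P.graph.r e) * isom e = isom (P.baseEdge (P.underEdge e)) := by
  rw [transfer_of_not_isSource hE (not_isSource_range e), Finset.sum_mul,
    Finset.sum_eq_single e]
  · rw [mul_assoc, star_isom_mul_isom, ← source_baseEdge, isom_mul_proj]
  · intro e' _ hne
    rw [mul_assoc, star_isom_mul_isom_of_ne hne, mul_zero]
  · intro h
    simp at h

theorem star_transfer_mul_isom (e : P.graph.Edge) :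
    star (transfer hE (P.graph.r e)) * isom (P.baseEdge (P.underEdge e)) = isom e := by
  rw [transfer_of_not_isSource hE (not_isSource_range e), star_sum, Finset.sum_mul,
    Finset.sum_eq_single e]
  · rw [star_mul, star_star, mul_assoc, star_isom_mul_isom, source_baseEdge, isom_mul_proj]
  · intro e' he' hne
    rw [star_mul, star_star, mul_assoc, star_isom_mul_isom_of_ne, mul_zero]
    intro h
    refine hne (edge_ext (baseEdge_injective h) ?_)
    simpa using he'
  · intro h
    simp at h

theorem star_transfer_mul_transfer (x : P.graph.Vertex) :
    star (transfer hE x) * transfer hE x = proj x := by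
  by_cases h : E.IsSource (P.under x)
  · rw [transfer_of_isSource hE h, star_proj, proj_mul_proj]
  · rw [(isCKFamily (E := P.graph)).ck2 x (rowFinite_graph hE x)
      (fun hx => h ((isSource_iff x).1 hx))]
    nth_rewrite 2 [transfer_of_not_isSource hE h]
    rw [Finset.mul_sum]
    refine Finset.sum_congr rfl fun e he => ?_
    obtain rfl : P.graph.r e = x := by simpa using he
    rw [← mul_assoc, star_transfer_mul_isom]

theorem proj_baseVertex_eq_sum {v : E.Vertex} (h : ¬ E.IsSource v) :
    (proj (P.baseVertex v) : GraphCStar P.graph)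
      = ∑ e ∈ (hE v).toFinset, isom (P.baseEdge e) * star (isom (P.baseEdge e)) := by
  have hsum := sum_underEdge (P := P) hE (P.baseVertex v)
    (fun e => isom (P.baseEdge e) * star (isom (P.baseEdge e)))
  simp only [under_baseVertex] at hsum
  rw [← hsum, (isCKFamily (E := P.graph)).ck2 _ (rowFinite_graph hE _)
    (fun hx => h (by simpa using (isSource_iff _).1 hx))]
  refine Finset.sum_congr rfl fun e he => ?_
  rw [baseEdge_underEdge (v := v) (by simpa using he)]

theorem transfer_mul_star_transfer (x : P.graph.Vertex) :
    transfer hE x * star (transfer hE x) = proj (P.baseVertex (P.under x)) := by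
  by_cases h : E.IsSource (P.under x)
  · rw [transfer_of_isSource hE h, star_proj, proj_mul_proj, baseVertex_of_isSource h]
  · rw [proj_baseVertex_eq_sum hE h, ← sum_underEdge hE x
      (fun e => isom (P.baseEdge e) * star (isom (P.baseEdge e)))]
    nth_rewrite 2 [transfer_of_not_isSource hE h]
    rw [star_sum, Finset.mul_sum]
    refine Finset.sum_congr rfl fun e he => ?_
    obtain rfl : P.graph.r e = x := by simpa using he
    rw [star_mul, star_star, ← mul_assoc, transfer_mul_isom]

theorem transfer_mul_proj (x : P.graph.Vertex) : transfer hE x * proj x = transfer hE x :=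
  GraphCStar.mul_eq_self_of_star_mul_self (star_transfer_mul_transfer hE x) (star_proj x)
    (proj_mul_proj x)

theorem proj_mul_transfer (x : P.graph.Vertex) :
    proj (P.baseVertex (P.under x)) * transfer hE x = transfer hE x := by
  have := GraphCStar.mul_eq_self_of_star_mul_self (a := star (transfer hE x))
    (by rw [star_star]; exact transfer_mul_star_transfer hE x) (star_proj _) (proj_mul_proj _)
  simpa [star_mul, star_proj] using congrArg star this

theorem transfer_baseVertex (v : E.Vertex) :
    transfer hE (P.baseVertex v) = proj (P.baseVertex v) := by
  by_cases h : E.IsSource v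
  · exact transfer_of_isSource hE (by simpa using h)
  · rw [transfer_of_not_isSource hE (by simpa using h),
      (isCKFamily (E := P.graph)).ck2 _ (rowFinite_graph hE _)
        (fun hx => h (by simpa using (isSource_iff _).1 hx))]
    refine Finset.sum_congr rfl fun e he => ?_
    rw [baseEdge_underEdge (v := v) (by simpa using he)]

end OutSplitting

/-! ### Limits of asymptotic Cuntz-Krieger families -/

theorem Filter.exists_tendsto_hyperfilter {a : ℕ → ℝ} {M : ℝ} (h0 : ∀ n, 0 ≤ a n)
    (hM : ∀ n, a n ≤ M) : ∃ r, Filter.Tendsto a (Filter.hyperfilter ℕ) (nhds r) := by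
  have hmem : Set.Icc 0 M ∈ (Filter.hyperfilter ℕ).map a :=
    Filter.mem_map.2 (Filter.univ_mem' fun n => ⟨h0 n, hM n⟩)
  obtain ⟨r, -, hr⟩ := isCompact_Icc.ultrafilter_le_nhds _ (Filter.le_principal_iff.2 hmem)
  exact ⟨r, hr⟩

/-- Uniformly bounded *-representations of the free *-algebra that satisfy each Cuntz-Krieger
relation from some point on define, through the limit of the norms along an ultrafilter, a
C*-seminorm that satisfies all of them. -/
theorem CKSeminorm.exists_of_asymptotic {E : DirectedGraph.{u}} {B : ℕ → Type w}
    [∀ n, NonUnitalCStarAlgebra (B n)] (ρ : ∀ n, CKFree E →⋆ₙₐ[ℂ] B n)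
    (hbdd : ∀ x, ∃ M, ∀ n, ‖ρ n x‖ ≤ M)
    (hrel : E.CKRelations (fun x y => ∀ᶠ n in Filter.atTop, ρ n x = ρ n y)
      CKFree.iso CKFree.proj) :
    ∃ q : CKSeminorm E, ∀ x,
      Filter.Tendsto (fun n => ‖ρ n x‖) (Filter.hyperfilter ℕ) (nhds (q.toSeminorm x)) := by
  have hex : ∀ x, ∃ r, Filter.Tendsto (fun n => ‖ρ n x‖) (Filter.hyperfilter ℕ) (nhds r) :=
    fun x => (hbdd x).elim fun M hM =>
      Filter.exists_tendsto_hyperfilter (fun n => norm_nonneg _) hM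
  choose q hq using hex
  have hzero : ∀ x y, (∀ᶠ n in Filter.atTop, ρ n x = ρ n y) → q (x - y) = 0 := fun x y hxy => by
    refine tendsto_nhds_unique (hq (x - y)) (tendsto_const_nhds.congr' ?_)
    filter_upwards [Nat.hyperfilter_le_atTop hxy] with n hn
    rw [map_sub, hn, sub_self, norm_zero]
  refine ⟨
    { toFun := q
      map_zero' := by simpa using hzero 0 0 (Filter.Eventually.of_forall fun _ => rfl)
      add_le' := fun x y => le_of_tendsto_of_tendsto (hq (x + y)) ((hq x).add (hq y))
        (Filter.Eventually.of_forall fun n => by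
          change ‖ρ n (x + y)‖ ≤ _
          rw [map_add]
          exact norm_add_le _ _)
      neg' := fun x => tendsto_nhds_unique (hq (-x)) (by simpa using hq x)
      smul' := fun c x => by
        refine tendsto_nhds_unique (hq (c • x)) ?_
        simpa [map_smul, norm_smul] using (hq x).const_mul ‖c‖
      mul_le' := fun x y => le_of_tendsto_of_tendsto (hq (x * y)) ((hq x).mul (hq y))
        (Filter.Eventually.of_forall fun n => by
          change ‖ρ n (x * y)‖ ≤ _
          rw [map_mul]
          exact norm_mul_le _ _)
      star_mul_self' := fun x => by
        refine tendsto_nhds_unique (hq (star x * x)) ?_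
        simpa [map_star, CStarRing.norm_star_mul_self] using (hq x).mul (hq x)
      relations' := by
        constructor <;> intros <;> refine hzero _ _ ?_
        · exact hrel.star_proj _
        · exact hrel.proj_mul_self _
        · exact hrel.proj_orthogonal _ _ ‹_›
        · exact hrel.range_orthogonal _ _ ‹_›
        · exact hrel.range_le _
        · exact hrel.ck1 _
        · exact hrel.ck2 _ ‹_› ‹_› }, hq⟩

/-! ### Elementary matrices -/

namespace CStarMatrix

variable {A : Type*} [NonUnitalCStarAlgebra A]

/-- The `n × n` matrix with entry `a` at the position `(i, j)` and zeros elsewhere. It is zero if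
the position lies outside the matrix. -/
def elementary (n i j : ℕ) (a : A) : CStarMatrix (Fin n) (Fin n) A :=
  ofMatrix fun k l => if (k : ℕ) = i ∧ (l : ℕ) = j then a else 0

theorem elementary_apply (n i j : ℕ) (a : A) (k l : Fin n) :
    elementary n i j a k l = if (k : ℕ) = i ∧ (l : ℕ) = j then a else 0 := rfl

theorem elementary_zero (n i j : ℕ) : elementary n i j (0 : A) = 0 :=
  CStarMatrix.ext fun k l => by simp [elementary_apply]

theorem elementary_add (n i j : ℕ) (a b : A) :
    elementary n i j (a + b) = elementary n i j a + elementary n i j b :=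
  CStarMatrix.ext fun k l => by
    simp only [elementary_apply, add_apply]; split_ifs <;> simp

theorem elementary_sum (n i j : ℕ) {κ : Type*} (s : Finset κ) (a : κ → A) :
    elementary n i j (∑ k ∈ s, a k) = ∑ k ∈ s, elementary n i j (a k) :=
  map_sum (AddMonoidHom.mk' (elementary n i j : A → _) (elementary_add n i j)) a s

theorem elementary_smul (n i j : ℕ) (c : ℂ) (a : A) :
    elementary n i j (c • a) = c • elementary n i j a :=
  CStarMatrix.ext fun k l => by
    simp only [elementary_apply, smul_apply]; split_ifs <;> simp

theorem star_elementary (n i j : ℕ) (a : A) :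
    star (elementary n i j a) = elementary n j i (star a) :=
  CStarMatrix.ext fun k l => by
    change star (elementary n i j a l k) = _
    simp only [elementary_apply, and_comm]
    split_ifs <;> simp

theorem elementary_mul {n j : ℕ} (hj : j < n) (i l : ℕ) (a b : A) :
    elementary n i j a * elementary n j l b = elementary n i l (a * b) :=
  CStarMatrix.ext fun x y => by
    rw [mul_apply, Finset.sum_eq_single ⟨j, hj⟩]
    · simp only [elementary_apply]
      by_cases h1 : (x : ℕ) = i <;> by_cases h2 : (y : ℕ) = l <;> simp [h1, h2]
    · intro k _ hk
      have : (k : ℕ) ≠ j := fun h => hk (Fin.ext h)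
      simp [elementary_apply, this]
    · simp

theorem elementary_mul_of_ne {n j j' : ℕ} (hj : j ≠ j') (i l : ℕ) (a b : A) :
    elementary n i j a * elementary n j' l b = 0 :=
  CStarMatrix.ext fun x y => by
    rw [mul_apply]
    refine Finset.sum_eq_zero fun k _ => ?_
    simp only [elementary_apply]
    by_cases h : (k : ℕ) = j
    · simp [h, hj]
    · simp [h]

theorem elementary_of_le {n i : ℕ} (hi : n ≤ i) (j : ℕ) (a : A) : elementary n i j a = 0 :=
  CStarMatrix.ext fun k l => by
    have : (k : ℕ) ≠ i := (k.2.trans_le hi).ne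
    simp [elementary_apply, this]

variable [PartialOrder A] [StarOrderedRing A]

/-- The embedding `a ↦ a ⊗ e_ii` for a diagonal position inside the matrix. -/
def elementaryHom {n i : ℕ} (hi : i < n) : A →⋆ₙₐ[ℂ] CStarMatrix (Fin n) (Fin n) A where
  toFun := elementary n i i
  map_smul' := elementary_smul n i i
  map_zero' := elementary_zero n i i
  map_add' := elementary_add n i i
  map_mul' a b := (elementary_mul hi i i a b).symm
  map_star' a := (star_elementary n i i a).symm

theorem norm_elementary_diag {n i : ℕ} (hi : i < n) (a : A) : ‖elementary n i i a‖ = ‖a‖ :=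
  NonUnitalStarAlgHom.norm_map (elementaryHom hi) (fun a b hab => by
    have := congrArg (fun M : CStarMatrix (Fin n) (Fin n) A => M ⟨i, hi⟩ ⟨i, hi⟩) hab
    simpa [elementaryHom, elementary_apply] using this) a

theorem norm_elementary_le (n i j : ℕ) (a : A) : ‖elementary n i j a‖ ≤ ‖a‖ := by
  rcases le_or_gt n i with hi | hi
  · rw [elementary_of_le hi, norm_zero]
    exact norm_nonneg _
  rcases le_or_gt n j with hj | hj
  · rw [← norm_star, star_elementary, elementary_of_le hj, norm_zero]
    exact norm_nonneg _
  have h := CStarRing.norm_star_mul_self (x := elementary n i j a)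
  rw [star_elementary, elementary_mul hi, norm_elementary_diag hj,
    CStarRing.norm_star_mul_self] at h
  exact (mul_self_inj (norm_nonneg _) (norm_nonneg _)).1 h |>.ge

end CStarMatrix

/-! ### The graph algebra as a corner of the algebra of its out-split -/

namespace OutSplitting

open GraphCStar

variable {E : DirectedGraph.{u}} {P : OutSplitting E} (hE : E.RowFinite)

/-- The copy `s_{e⁰} U*` of `s_e`, where `U` carries the projection at the source of `e⁰` to that of
copy `0`. -/
def cornerIsom (P : OutSplitting E) (hE : E.RowFinite) (e : E.Edge) : GraphCStar P.graph :=
  isom (P.baseEdge e) * star (transfer hE (P.graph.s (P.baseEdge e)))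

theorem cornerIsom_eq (e : P.graph.Edge) : cornerIsom P hE (P.underEdge e)
    = transfer hE (P.graph.r e) * isom e * star (transfer hE (P.graph.s e)) := by
  rw [cornerIsom, source_baseEdge, transfer_mul_isom]

theorem cornerIsom_mul_star (e : E.Edge) : cornerIsom P hE e * star (cornerIsom P hE e)
    = isom (P.baseEdge e) * star (isom (P.baseEdge e)) := by
  calc _ = isom (P.baseEdge e) * (star (transfer hE (P.graph.s (P.baseEdge e))) *
        transfer hE (P.graph.s (P.baseEdge e))) * star (isom (P.baseEdge e)) := by
        simp only [cornerIsom, star_mul, star_star, mul_assoc]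
    _ = _ := by rw [star_transfer_mul_transfer, isom_mul_proj]

theorem isCKFamily_corner (P : OutSplitting E) (hE : E.RowFinite) :
    E.IsCKFamily (cornerIsom P hE) (fun v => (proj (P.baseVertex v) : GraphCStar P.graph)) where
  star_proj v := star_proj _
  proj_mul_self v := proj_mul_proj _
  proj_orthogonal v w hvw := proj_mul_proj_of_ne fun h => hvw (by simpa using congrArg P.under h)
  range_orthogonal e e' h := by
    calc _ = transfer hE (P.graph.s (P.baseEdge e)) * (star (isom (P.baseEdge e)) *
          isom (P.baseEdge e')) * star (transfer hE (P.graph.s (P.baseEdge e'))) := by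
          simp only [cornerIsom, star_mul, star_star, mul_assoc]
      _ = 0 := by
          rw [star_isom_mul_isom_of_ne (baseEdge_injective.ne h), mul_zero, zero_mul]
  range_le e := by rw [cornerIsom, ← mul_assoc, ← range_baseEdge, proj_mul_isom]
  ck1 e := by
    calc _ = transfer hE (P.graph.s (P.baseEdge e)) * (star (isom (P.baseEdge e)) *
          isom (P.baseEdge e)) * star (transfer hE (P.graph.s (P.baseEdge e))) := by
          simp only [cornerIsom, star_mul, star_star, mul_assoc]
      _ = _ := by
          rw [star_isom_mul_isom, transfer_mul_proj, transfer_mul_star_transfer, under_source,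
            underEdge_baseEdge]
  ck2 v hv hs := by
    rw [proj_baseVertex_eq_sum hE hs]
    exact Finset.sum_congr rfl fun e _ => (cornerIsom_mul_star hE e).symm

/-- The embedding of `C*(E)` in the algebra of the out-split graph as the corner cut out by the
copies with number `0`. -/
def cornerHom (P : OutSplitting E) (hE : E.RowFinite) :
    GraphCStar E →⋆ₙₐ[ℂ] GraphCStar P.graph :=
  lift (isCKFamily_corner P hE)

theorem cornerHom_isom (e : E.Edge) : cornerHom P hE (isom e) = cornerIsom P hE e := lift_isom _ e

theorem cornerHom_proj (v : E.Vertex) : cornerHom P hE (proj v) = proj (P.baseVertex v) :=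
  lift_proj _ v

/-- The lift of `cornerHom` to the free *-algebras. -/
def cornerFree (P : OutSplitting E) (hE : E.RowFinite) : CKFree E →⋆ₙₐ[ℂ] CKFree P.graph :=
  CKFree.eval (fun e => CKFree.iso (P.baseEdge e) *
      star (transferFree hE (P.graph.s (P.baseEdge e))))
    (fun v => CKFree.proj (P.baseVertex v)) (fun _ => CKFree.star_proj _)

theorem cornerHom_of (x : CKFree E) : cornerHom P hE (of x) = of (cornerFree P hE x) := by
  induction x using CKFree.induction_gen with
  | zero => simp
  | add x y hx hy => simp only [map_add, hx, hy]
  | smul c x hx => simp only [map_smul, hx]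
  | mul x y hx hy => simp only [of_mul, map_mul, hx, hy]
  | iso e =>
    refine (cornerHom_isom hE e).trans ?_
    rw [cornerFree, CKFree.eval_iso, of_mul, of_star]
    rfl
  | star_iso e =>
    rw [of_star, map_star, map_star, of_star]
    refine congrArg star ((cornerHom_isom hE e).trans ?_)
    rw [cornerFree, CKFree.eval_iso, of_mul, of_star]
    rfl
  | proj v =>
    refine (cornerHom_proj hE v).trans ?_
    rw [cornerFree, CKFree.eval_proj]
    rfl

theorem eventually_idx_lt (x : P.graph.Vertex) : ∀ᶠ n in Filter.atTop, P.idx x < n :=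
  Filter.eventually_gt_atTop _

section Matrices

open CStarMatrix

variable [PartialOrder (GraphCStar E)] [StarOrderedRing (GraphCStar E)]

/-- The representation of the free *-algebra of the out-split graph by `n × n` matrices over
`C*(E)`, with the number of a copy as matrix index: `s_{eⁱ} ↦ s_e ⊗ e_ij` if `eⁱ` starts at a copy
with number `j`. Everything outside the matrix is cut off, so each Cuntz-Krieger relation holds
only for large `n`. -/
def matrixRep (P : OutSplitting E) (n : ℕ) :
    CKFree P.graph →⋆ₙₐ[ℂ] CStarMatrix (Fin n) (Fin n) (GraphCStar E) :=
  CKFree.eval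
    (fun e => elementary n (P.idx (P.graph.r e)) (P.idx (P.graph.s e)) (isom (P.underEdge e)))
    (fun x => elementary n (P.idx x) (P.idx x) (proj (P.under x)))
    (fun x => by rw [star_elementary, star_proj])

theorem matrixRep_iso (n : ℕ) (e : P.graph.Edge) : matrixRep P n (CKFree.iso e)
    = elementary n (P.idx (P.graph.r e)) (P.idx (P.graph.s e)) (isom (P.underEdge e)) :=
  CKFree.eval_iso _ _ _ e

theorem matrixRep_proj (n : ℕ) (x : P.graph.Vertex) : matrixRep P n (CKFree.proj x)
    = elementary n (P.idx x) (P.idx x) (proj (P.under x)) :=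
  CKFree.eval_proj _ _ _ x

theorem matrixRep_relations (hE : E.RowFinite) :
    P.graph.CKRelations (fun x y => ∀ᶠ n in Filter.atTop, matrixRep P n x = matrixRep P n y)
      CKFree.iso CKFree.proj where
  star_proj x := Filter.Eventually.of_forall fun n => by rw [CKFree.star_proj]
  proj_mul_self x := by
    filter_upwards [eventually_idx_lt x] with n hn
    rw [map_mul, matrixRep_proj, elementary_mul hn, proj_mul_proj]
  proj_orthogonal x y hxy := by
    filter_upwards [eventually_idx_lt x] with n hn
    rw [map_mul, map_zero, matrixRep_proj, matrixRep_proj]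
    by_cases hi : P.idx x = P.idx y
    · rw [← hi, elementary_mul hn, proj_mul_proj_of_ne fun h => hxy (vertex_ext h hi),
        elementary_zero]
    · exact elementary_mul_of_ne hi _ _ _ _
  range_orthogonal e e' hee := by
    filter_upwards [eventually_idx_lt (P.graph.r e)] with n hn
    rw [map_mul, map_zero, map_star, matrixRep_iso, matrixRep_iso, star_elementary]
    by_cases hi : P.idx (P.graph.r e) = P.idx (P.graph.r e')
    · rw [← hi, elementary_mul hn, star_isom_mul_isom_of_ne, elementary_zero]
      intro h
      refine hee (edge_ext h (vertex_ext ?_ hi))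
      rw [under_range, under_range, h]
    · exact elementary_mul_of_ne hi _ _ _ _
  range_le e := by
    filter_upwards [eventually_idx_lt (P.graph.r e)] with n hn
    rw [map_mul, matrixRep_iso, matrixRep_proj, elementary_mul hn, under_range, proj_mul_isom]
  ck1 e := by
    filter_upwards [eventually_idx_lt (P.graph.r e)] with n hn
    rw [map_mul, map_star, matrixRep_iso, matrixRep_proj, star_elementary, elementary_mul hn,
      star_isom_mul_isom, under_source]
  ck2 x hx hs := by
    have hall : ∀ᶠ n in Filter.atTop, ∀ e ∈ hx.toFinset, P.idx (P.graph.s e) < n :=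
      (Filter.eventually_all_finset _).2 fun e _ => eventually_idx_lt _
    filter_upwards [hall] with n hn
    rw [matrixRep_proj, map_sum, (isCKFamily (E := E)).ck2 _ (hE _)
      (fun h => hs ((isSource_iff x).2 h)), ← sum_underEdge hE x
      (fun e => isom e * star (isom e)), elementary_sum]
    refine Finset.sum_congr rfl fun e he => ?_
    obtain rfl : P.graph.r e = x := by simpa using he
    rw [map_mul, map_star, matrixRep_iso, star_elementary, elementary_mul (hn e he)]

/-- The transfer elements are represented by the partial isometries `p_v ⊗ e_0i`. -/
theorem matrixRep_transferFree (x : P.graph.Vertex) : ∀ᶠ n in Filter.atTop,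
    matrixRep P n (transferFree hE x) = elementary n 0 (P.idx x) (proj (P.under x)) := by
  by_cases h : E.IsSource (P.under x)
  · refine Filter.Eventually.of_forall fun n => ?_
    rw [transferFree, if_pos h, matrixRep_proj]
    have := idx_baseVertex (P := P) (P.under x)
    rw [baseVertex_of_isSource h] at this
    rw [this]
  · have hall : ∀ᶠ n in Filter.atTop, ∀ e ∈ (rowFinite_graph hE x).toFinset,
        P.idx (P.graph.s e) < n :=
      (Filter.eventually_all_finset _).2 fun e _ => eventually_idx_lt _
    filter_upwards [hall] with n hn
    rw [transferFree, if_neg h, map_sum, (isCKFamily (E := E)).ck2 _ (hE _) h,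
      ← sum_underEdge hE x (fun e => isom e * star (isom e)), elementary_sum]
    refine Finset.sum_congr rfl fun e he => ?_
    obtain rfl : P.graph.r e = x := by simpa using he
    rw [map_mul, map_star, matrixRep_iso, matrixRep_iso, star_elementary, source_baseEdge,
      elementary_mul (hn e he), range_baseEdge, idx_baseVertex, underEdge_baseEdge]

theorem matrixRep_cornerFree (x : CKFree E) : ∀ᶠ n in Filter.atTop,
    matrixRep P n (cornerFree P hE x) = elementary n 0 0 (of x) := by
  have hiso : ∀ e, ∀ᶠ n in Filter.atTop, matrixRep P n (cornerFree P hE (CKFree.iso e))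
      = elementary n 0 0 (of (CKFree.iso e)) := fun e => by
    filter_upwards [matrixRep_transferFree hE (P.graph.s (P.baseEdge e)),
      eventually_idx_lt (P.graph.s (P.baseEdge e))] with n hn hlt
    rw [cornerFree, CKFree.eval_iso, map_mul, map_star, hn, matrixRep_iso, star_elementary,
      elementary_mul hlt, range_baseEdge, idx_baseVertex, star_proj, under_source,
      underEdge_baseEdge, isom_mul_proj]
    rfl
  induction x using CKFree.induction_gen with
  | zero =>
    refine Filter.Eventually.of_forall fun n => ?_
    simp only [map_zero, elementary_zero]
  | add x y hx hy =>
    filter_upwards [hx, hy] with n hx hy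
    rw [map_add, map_add, hx, hy, of_add, elementary_add]
  | smul c x hx =>
    filter_upwards [hx] with n hx
    rw [map_smul, map_smul, hx, of_smul, elementary_smul]
  | mul x y hx hy =>
    filter_upwards [hx, hy, Filter.eventually_gt_atTop 0] with n hx hy hn
    rw [map_mul, map_mul, hx, hy, of_mul, elementary_mul hn]
  | iso e => exact hiso e
  | star_iso e =>
    filter_upwards [hiso e] with n hn
    rw [map_star, map_star, hn, star_elementary, of_star]
  | proj v =>
    refine Filter.Eventually.of_forall fun n => ?_
    rw [cornerFree, CKFree.eval_proj, matrixRep_proj, idx_baseVertex, under_baseVertex]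
    rfl

theorem bounded_matrixRep (x : CKFree P.graph) : ∃ M, ∀ n, ‖matrixRep P n x‖ ≤ M := by
  induction x using CKFree.induction_gen with
  | zero => exact ⟨0, fun n => by simp⟩
  | add x y hx hy =>
    obtain ⟨M, hM⟩ := hx
    obtain ⟨N, hN⟩ := hy
    exact ⟨M + N, fun n => by
      rw [map_add]; exact (norm_add_le _ _).trans (add_le_add (hM n) (hN n))⟩
  | smul c x hx =>
    obtain ⟨M, hM⟩ := hx
    exact ⟨‖c‖ * M, fun n => by
      rw [map_smul, norm_smul]; exact mul_le_mul_of_nonneg_left (hM n) (norm_nonneg _)⟩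
  | mul x y hx hy =>
    obtain ⟨M, hM⟩ := hx
    obtain ⟨N, hN⟩ := hy
    exact ⟨M * N, fun n => by
      rw [map_mul]
      exact (norm_mul_le _ _).trans (mul_le_mul (hM n) (hN n) (norm_nonneg _)
        ((norm_nonneg _).trans (hM n)))⟩
  | iso e => exact ⟨_, fun n => by rw [matrixRep_iso]; exact norm_elementary_le _ _ _ _⟩
  | star_iso e =>
    exact ⟨_, fun n => by rw [map_star, norm_star, matrixRep_iso]; exact norm_elementary_le _ _ _ _⟩
  | proj v => exact ⟨_, fun n => by rw [matrixRep_proj]; exact norm_elementary_le _ _ _ _⟩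

end Matrices

/-- The embedding of the corner is isometric: for the C*-seminorm obtained from the matrix
representations, the image of `x` has the norm of `x ⊗ e₀₀`, which is the universal norm of `x`. -/
theorem norm_cornerHom (a : GraphCStar E) : ‖cornerHom P hE a‖ = ‖a‖ := by
  let _ : PartialOrder (GraphCStar E) := CStarAlgebra.spectralOrder _
  have _ : StarOrderedRing (GraphCStar E) := CStarAlgebra.spectralOrderedRing _
  obtain ⟨q, hq⟩ := CKSeminorm.exists_of_asymptotic (matrixRep P) bounded_matrixRep
    (matrixRep_relations hE)
  have hc : Continuous (cornerHom P hE) := (cornerHom P hE).continuous'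
  refine le_antisymm (NonUnitalStarAlgHom.norm_apply_le _ a) ?_
  induction a using induction₁ with
  | hp => exact isClosed_le (by fun_prop) (by fun_prop)
  | h x =>
    have hx : q.toSeminorm (cornerFree P hE x) = ‖of x‖ := by
      refine tendsto_nhds_unique (hq _) (tendsto_const_nhds.congr' ?_)
      filter_upwards [Nat.hyperfilter_le_atTop (matrixRep_cornerFree hE x),
        Nat.hyperfilter_le_atTop (Filter.eventually_gt_atTop 0)] with n hn hpos
      rw [show matrixRep P n (cornerFree P hE x) = CStarMatrix.elementary n 0 0 (of x) from hn,
        CStarMatrix.norm_elementary_diag hpos]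
    rw [cornerHom_of, ← hx, of.norm_map]
    exact CKFree.le_univNorm q _

theorem cornerHom_injective : Function.Injective (cornerHom P hE) :=
  (AddMonoidHomClass.isometry_of_norm _ (norm_cornerHom hE)).injective

end OutSplitting

namespace OutSplitting

open GraphCStar

variable {E : DirectedGraph.{u}} {P : OutSplitting E} (hE : E.RowFinite)

/-! ### The corner is full and hereditary -/

theorem isClosed_range_cornerHom :
    IsClosed (NonUnitalStarAlgHom.range (cornerHom P hE) : Set (GraphCStar P.graph)) := by
  simpa using (AddMonoidHomClass.isometry_of_norm _
    (norm_cornerHom (P := P) hE)).isClosedEmbedding.isClosed_range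

theorem transfer_mul_proj_mul {x y : P.graph.Vertex} (h : x ≠ y) (a : GraphCStar P.graph) :
    transfer hE x * (proj y * a) = 0 := by
  rw [← transfer_mul_proj, mul_assoc, ← mul_assoc (proj x), proj_mul_proj_of_ne h, zero_mul,
    mul_zero]

/-- Every letter has a range vertex `x` and a source vertex `y`, and the transfer elements at these
carry it into the corner. -/
theorem exists_transfer_letter_mem (a : CKLetter P.graph) :
    ∃ x y, proj x * of (CKFree.word (FreeSemigroup.of a) 1) * proj y
        = of (CKFree.word (FreeSemigroup.of a) 1) ∧
      transfer hE x * of (CKFree.word (FreeSemigroup.of a) 1) * star (transfer hE y)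
        ∈ NonUnitalStarAlgHom.range (cornerHom P hE) := by
  rcases a with x | e | e
  · refine ⟨x, x, ?_, proj (P.under x), ?_⟩
    · rw [of_word_proj, proj_mul_proj, proj_mul_proj]
    · change cornerHom P hE (proj (P.under x)) = _
      rw [of_word_proj, cornerHom_proj, transfer_mul_proj, transfer_mul_star_transfer]
  · refine ⟨P.graph.r e, P.graph.s e, ?_, isom (P.underEdge e), ?_⟩
    · rw [of_word_iso, proj_mul_isom, isom_mul_proj]
    · change cornerHom P hE (isom (P.underEdge e)) = _
      rw [of_word_iso, cornerHom_isom, cornerIsom_eq]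
  · refine ⟨P.graph.s e, P.graph.r e, ?_, star (isom (P.underEdge e)), ?_⟩
    · rw [of_word_isoStar]
      calc _ = star (proj (P.graph.r e) * isom e * proj (P.graph.s e)) := by
            simp only [star_mul, star_proj, mul_assoc]
        _ = _ := by rw [proj_mul_isom, isom_mul_proj]
    · change cornerHom P hE (star (isom (P.underEdge e))) = _
      rw [of_word_isoStar, map_star, cornerHom_isom, cornerIsom_eq]
      simp only [star_mul, star_star, mul_assoc]

/-- The transfer elements compress the whole algebra into the corner. For a word this is shown one
letter at a time: inserting `U* U` between two letters leaves the word unchanged. -/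
theorem transfer_mul_mul_star_transfer_mem (b : GraphCStar P.graph) (x y : P.graph.Vertex) :
    transfer hE x * b * star (transfer hE y) ∈ NonUnitalStarAlgHom.range (cornerHom P hE) := by
  let R := NonUnitalStarAlgHom.range (cornerHom P hE)
  have hletter : ∀ (a : CKLetter P.graph) (x y : P.graph.Vertex),
      transfer hE x * of (CKFree.word (FreeSemigroup.of a) 1) * star (transfer hE y) ∈ R := by
    intro a x y
    obtain ⟨l, k, hlk, hmem⟩ := exists_transfer_letter_mem hE a
    by_cases hx : x = l
    · by_cases hy : y = k
      · rw [hx, hy]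
        exact hmem
      · have h0 : proj k * star (transfer hE y) = 0 := by
          rw [← transfer_mul_proj, star_mul, star_proj, ← mul_assoc,
            proj_mul_proj_of_ne (Ne.symm hy), zero_mul]
        rw [← hlk, mul_assoc, mul_assoc (_ * _), h0, mul_zero, mul_zero]
        exact zero_mem _
    · rw [← hlk, mul_assoc (proj l), transfer_mul_proj_mul hE hx, zero_mul]
      exact zero_mem _
  have hword : ∀ (m : FreeSemigroup (CKLetter P.graph)) (x y : P.graph.Vertex),
      transfer hE x * of (CKFree.word m 1) * star (transfer hE y) ∈ R := by
    intro m
    induction m using FreeSemigroup.recOnMul with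
    | ih1 a => exact hletter a
    | ih2 a m _ ih =>
      intro x y
      obtain ⟨l, k, hlk, -⟩ := exists_transfer_letter_mem hE a
      have hk : of (CKFree.word (FreeSemigroup.of a) 1) * proj k
          = of (CKFree.word (FreeSemigroup.of a) 1) := by
        rw [← hlk, mul_assoc, proj_mul_proj]
      have := mul_mem (hletter a x k) (ih k y)
      rw [of_word_mul, ← hk, ← star_transfer_mul_transfer hE]
      simpa only [mul_assoc] using this
  let T : Submodule ℂ (GraphCStar P.graph) :=
    { carrier := {b | transfer hE x * b * star (transfer hE y) ∈ R}
      add_mem' := fun {a b} ha hb => by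
        change transfer hE x * (a + b) * star (transfer hE y) ∈ R
        rw [mul_add, add_mul]
        exact add_mem ha hb
      zero_mem' := by
        change transfer hE x * 0 * star (transfer hE y) ∈ R
        rw [mul_zero, zero_mul]
        exact zero_mem _
      smul_mem' := fun c a ha => by
        change transfer hE x * (c • a) * star (transfer hE y) ∈ R
        rw [mul_smul_comm, smul_mul_assoc]
        exact SMulMemClass.smul_mem c ha }
  have hT : IsClosed (T : Set (GraphCStar P.graph)) :=
    (isClosed_range_cornerHom hE).preimage (by fun_prop)
  exact mem_of_word_mem (T := T) hT (fun m => hword m x y) b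

theorem dense_span_mul_cornerHom_proj_mul :
    Dense (Submodule.span ℂ {x : GraphCStar P.graph | ∃ v b c,
      x = b * cornerHom P hE (proj v) * c} : Set (GraphCStar P.graph)) := by
  rw [Submodule.dense_iff_topologicalClosure_eq_top, eq_top_iff]
  rintro b -
  refine mem_of_word_mem (Submodule.isClosed_topologicalClosure _) (fun m => ?_) b
  obtain ⟨x, hx⟩ := exists_proj_mul_word m
  refine Submodule.le_topologicalClosure _ (Submodule.subset_span
    ⟨P.under x, star (transfer hE x), transfer hE x * of (CKFree.word m 1), ?_⟩)
  rw [cornerHom_proj, mul_assoc, ← mul_assoc (proj _), proj_mul_transfer, ← mul_assoc,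
    star_transfer_mul_transfer, hx]

/-! ### The corner and the circle actions -/

/-- The transfer elements have degree `0`, as all copies of an edge carry the same weight. -/
theorem gaugeHom_transfer (f : E.Edge → ℤ) (z : Circle) (x : P.graph.Vertex) :
    gaugeHom (E := P.graph) (fun e => f (P.underEdge e)) z (transfer hE x) = transfer hE x := by
  by_cases h : E.IsSource (P.under x)
  · rw [transfer_of_isSource hE h, gaugeHom_proj]
  · rw [transfer_of_not_isSource hE h, map_sum]
    refine Finset.sum_congr rfl fun e _ => ?_
    have hz : ∀ w : Circle, (w : ℂ) * star (w : ℂ) = 1 := fun w => by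
      have := Complex.mul_conj' (w : ℂ)
      rw [Circle.norm_coe] at this
      simpa using this
    rw [map_mul, map_star, gaugeHom_isom, gaugeHom_isom, underEdge_baseEdge, star_smul,
      smul_mul_smul_comm, hz, one_smul]

theorem cornerHom_gaugeHom (f : E.Edge → ℤ) (z : Circle) (a : GraphCStar E) :
    cornerHom P hE (gaugeHom f z a)
      = gaugeHom (E := P.graph) (fun e => f (P.underEdge e)) z (cornerHom P hE a) := by
  have : (cornerHom P hE).comp (gaugeHom f z)
      = (gaugeHom (E := P.graph) (fun e => f (P.underEdge e)) z).comp (cornerHom P hE) := by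
    refine hom_ext (fun e => ?_) (fun v => ?_)
    · rw [NonUnitalStarAlgHom.comp_apply, NonUnitalStarAlgHom.comp_apply, gaugeHom_isom, map_smul,
        cornerHom_isom, cornerIsom, map_mul, map_star, gaugeHom_transfer, gaugeHom_isom,
        underEdge_baseEdge, smul_mul_assoc]
    · rw [NonUnitalStarAlgHom.comp_apply, NonUnitalStarAlgHom.comp_apply, gaugeHom_proj,
        cornerHom_proj, gaugeHom_proj]
  exact DFunLike.congr_fun this a

/-! ### The corner and the diagonals -/

theorem cornerHom_isom_mul_transfer_mul (e : P.graph.Edge) (a : GraphCStar P.graph) :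
    cornerHom P hE (isom (P.underEdge e)) * (transfer hE (P.graph.s e) * a)
      = transfer hE (P.graph.r e) * (isom e * a) := by
  calc _ = transfer hE (P.graph.r e) * (isom e * (star (transfer hE (P.graph.s e)) *
        transfer hE (P.graph.s e))) * a := by
        rw [cornerHom_isom, cornerIsom_eq]
        simp only [mul_assoc]
    _ = _ := by rw [star_transfer_mul_transfer, isom_mul_proj, mul_assoc]

/-- Paths of the out-split graph project to paths of `E`, and the projection of a path represents
its compression to the corner. -/
theorem exists_cornerHom_path_eq {x y : P.graph.Vertex} (μ : FinitePath P.graph x y) :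
    ∃ (v w : E.Vertex) (ν : FinitePath E v w), v = P.under x ∧
      cornerHom P hE (path ν) = transfer hE x * path μ * star (transfer hE y) := by
  induction μ with
  | vertex x =>
    refine ⟨_, _, FinitePath.vertex (P.under x), rfl, ?_⟩
    rw [path, path, cornerHom_proj, transfer_mul_proj, transfer_mul_star_transfer]
  | cons e μ ih =>
    obtain ⟨v, w, ν, hv, hν⟩ := ih
    rw [under_source] at hv
    subst hv
    refine ⟨_, _, FinitePath.cons (P.underEdge e) ν, (under_range e).symm, ?_⟩
    rw [path, path, map_mul, hν, mul_assoc (transfer hE _), cornerHom_isom_mul_transfer_mul]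
    simp only [mul_assoc]

/-- Paths of `E` lift to paths of the out-split graph, with any prescribed range over the given
one. -/
theorem exists_path_over {v w : E.Vertex} (ν : FinitePath E v w) (x : P.graph.Vertex)
    (hx : P.under x = v) :
    ∃ (x' y : P.graph.Vertex) (μ : FinitePath P.graph x' y), x' = x ∧
      cornerHom P hE (path ν) = transfer hE x * path μ * star (transfer hE y) := by
  induction ν generalizing x with
  | vertex v =>
    subst hx
    refine ⟨_, _, FinitePath.vertex x, rfl, ?_⟩
    rw [path, path, cornerHom_proj, transfer_mul_proj, transfer_mul_star_transfer]
  | cons e ν ih =>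
    obtain ⟨e, rfl, rfl⟩ := exists_edge x e hx.symm
    obtain ⟨x', y, μ, hx', hμ⟩ := ih (P.graph.s e) (under_source e)
    subst hx'
    refine ⟨_, _, FinitePath.cons e μ, rfl, ?_⟩
    rw [path, path, map_mul, hμ, mul_assoc (transfer hE _), cornerHom_isom_mul_transfer_mul]
    simp only [mul_assoc]

theorem cornerHom_rangeProj {v w : E.Vertex} {ν : FinitePath E v w} {x y : P.graph.Vertex}
    {μ : FinitePath P.graph x y}
    (h : cornerHom P hE (path ν) = transfer hE x * path μ * star (transfer hE y)) :
    cornerHom P hE (rangeProj ν) = transfer hE x * rangeProj μ * star (transfer hE x) := by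
  rw [rangeProj, map_mul, map_star, h]
  calc _ = transfer hE x * (path μ * (star (transfer hE y) * transfer hE y)) * star (path μ) *
        star (transfer hE x) := by simp only [star_mul, star_star, mul_assoc]
    _ = _ := by
        rw [star_transfer_mul_transfer, path_mul_proj, rangeProj]
        simp only [mul_assoc]

theorem cornerHom_mem_diagonal {d : GraphCStar E} (hd : d ∈ diagonal E) :
    cornerHom P hE d ∈ diagonal P.graph := by
  have hc : Continuous (cornerHom P hE) := (cornerHom P hE).continuous'
  refine diagonal_induction (motive := fun d => cornerHom P hE d ∈ diagonal P.graph)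
    (isClosed_diagonal.preimage hc) (fun {v w} ν => ?_) (by simp)
    (fun x y hx hy => by rw [map_add]; exact add_mem hx hy)
    (fun c x hx => by rw [map_smul]; exact SMulMemClass.smul_mem c hx)
    (fun x hx => by rw [map_star]; exact star_mem hx)
    (fun x _ y _ hx hy => by rw [map_mul]; exact mul_mem hx hy) hd
  obtain ⟨x, y, μ, rfl, hμ⟩ := exists_path_over hE ν (P.baseVertex v) (under_baseVertex v)
  rw [cornerHom_rangeProj hE hμ, transfer_baseVertex, star_proj]
  exact mul_mem (mul_mem (proj_mem_diagonal _) (rangeProj_mem_diagonal μ)) (proj_mem_diagonal _)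

/-- Compression to a copy with number `0` carries the diagonal into the image of the diagonal. It is
multiplicative there because the diagonal is commutative, so paths suffice; a path with range in
the corner is the lift of a path of `E`. -/
theorem exists_cornerHom_eq_compress {d : GraphCStar P.graph} (hd : d ∈ diagonal P.graph)
    (v : E.Vertex) : ∃ d' ∈ diagonal E,
      cornerHom P hE d' = cornerHom P hE (proj v) * d * cornerHom P hE (proj v) := by
  rw [cornerHom_proj]
  set p : GraphCStar P.graph := proj (P.baseVertex v) with hp
  let R : NonUnitalStarSubalgebra ℂ (GraphCStar P.graph) := (diagonal E).map (cornerHom P hE)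
  have hR : IsClosed (R : Set (GraphCStar P.graph)) :=
    (AddMonoidHomClass.isometry_of_norm _
      (norm_cornerHom (P := P) hE)).isClosedEmbedding.isClosedMap _ isClosed_diagonal
  refine diagonal_induction (motive := fun d => p * d * p ∈ R) (hR.preimage (by fun_prop))
    (fun {x y} μ => ?_) (by simp)
    (fun x y hx hy => by rw [mul_add, add_mul]; exact add_mem hx hy)
    (fun c x hx => by
      rw [mul_smul_comm, smul_mul_assoc]
      exact SMulMemClass.smul_mem c hx)
    (fun x hx => by
      have := star_mem hx
      simpa only [star_mul, hp, star_proj, mul_assoc] using this)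
    (fun x hx y hy hpx hpy => ?_) hd
  · by_cases h : P.baseVertex v = x
    · subst h
      obtain ⟨v', w, ν, hv, hν⟩ := exists_cornerHom_path_eq hE μ
      refine ⟨rangeProj ν, rangeProj_mem_diagonal ν, (cornerHom_rangeProj hE hν).trans ?_⟩
      rw [transfer_baseVertex, star_proj]
    · rw [hp, proj_mul_rangeProj_of_ne h, zero_mul]
      exact zero_mem _
  · have hpD : p ∈ diagonal P.graph := proj_mem_diagonal _
    have hpp : p * p = p := proj_mul_proj _
    have hxy : p * x * p * (p * y * p) = p * (x * y) * p := by
      calc _ = p * (x * (p * p)) * y * p := by simp only [mul_assoc]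
        _ = p * x * y * p := by
            rw [hpp, diagonal_comm hx hpD, ← mul_assoc, hpp]
        _ = _ := by simp only [mul_assoc]
    have := mul_mem hpx hpy
    rwa [hxy] at this

theorem isFullDiagonalCorner (P : OutSplitting E) (f : E.Edge → ℤ) :
    IsFullDiagonalCorner (gaugeAction E f) (diagonal E)
      (gaugeAction P.graph fun e => f (P.underEdge e)) (diagonal P.graph) (cornerHom P hE)
      (proj : E.Vertex → GraphCStar E) where
  injective := cornerHom_injective hE
  equivariant z a := cornerHom_gaugeHom hE f z a
  star_proj := star_proj
  proj_mul_self := proj_mul_proj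
  proj_mem := proj_mem_diagonal
  proj_fixed v z := gaugeHom_proj f z v
  dense_proj := dense_span_proj_mul
  hereditary v w b := by
    have := transfer_mul_mul_star_transfer_mem hE b (P.baseVertex v) (P.baseVertex w)
    rw [transfer_baseVertex, transfer_baseVertex, star_proj] at this
    rw [cornerHom_proj, cornerHom_proj]
    exact this
  full := dense_span_mul_cornerHom_proj_mul hE
  isDiagonal₁ := isDiagonal_diagonal E
  isDiagonal₂ := isDiagonal_diagonal P.graph
  map_diagonal d hd := cornerHom_mem_diagonal hE hd
  compress_diagonal v d hd := exists_cornerHom_eq_compress hE hd v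

end OutSplitting

end

theorem mainTheorem3 (E₁ : DirectedGraph.{u}) (hE₁ : E₁.RowFinite) (P : OutSplitting E₁)
    (hP : P.Proper) (f : E₁.Edge → ℤ) :
    ∃ g : P.graph.Edge → ℤ,
      MoritaEquivalent
        (GraphCStar.gaugeAction E₁ f) (GraphCStar.diagonal E₁)
        (GraphCStar.gaugeAction P.graph g) (GraphCStar.diagonal P.graph) :=
  ⟨fun e => f (P.underEdge e), (OutSplitting.isFullDiagonalCorner hE₁ P f).moritaEquivalent⟩
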